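/- Let $p$ be a prime. For a profinite group $G$ write $H^i(G)=H^i(G,\mathbb{Z}/p)$ for continuous cochain cohomology with trivial action on $\mathbb{Z}/p$. Let $\bar G$ be a pro-$p$ group, let $\bar\theta\colon\bar G\to 1+p\mathbb{Z}_p$ be a continuous homomorphism, let $m$ be a (possibly infinite) cardinal number, let $A=\mathbb{Z}_p^m$ (direct power with the product topology), and let $G=A\rtimes\bar G$ be the semidirect product with respect to the action $\bar g a\bar g^{-1}=\bar\theta(\bar g)a$ for $\bar g\in\bar G$, $a\in A$, with inflation $\inf\colon H^*(\bar G)\to H^*(G)$ along the projection $G\to\bar G$. Let $(L,\le)$ be a totally ordered set of cardinality $m$, and let $\beta_l\in H^1(G)$, $l\in L$, be elements whose restrictions to $A$ form an $\mathbb{F}_p$-linear basis of $H^1(A)$ and whose restrictions to $\bar G$ are zero. Then for every $i\ge 0$ \[ H^i(G)=\bigoplus_{j=0}^{i}\ \bigoplus_{\substack{l_1,\dots,l_j\in L\\ l_1<\cdots<l_j}}\inf\bigl(H^{i-j}(\bar G)\bigr)\cup\beta_{l_1}\cup\cdots\cup\beta_{l_j}. \] Moreover, for every $0\le j\le i$ and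 every list $l_1<\cdots<l_j$ in $L$, the map \[ H^{i-j}(\bar G)\to H^i(G),\qquad \bar\varphi\mapsto\inf(\bar\varphi)\cup\beta_{l_1}\cup\cdots\cup\beta_{l_j}, \] is injective. -/

import Mathlib

open scoped SemidirectProduct

noncomputable section

/-! ## Cohomology of a topological group with coefficients in `ℤ/p` (trivial action)

`H^n(G) = H^n(G, ℤ/p)` is the cohomology of the standard complex of inhomogeneous continuous
cochains `G^n → ℤ/p`, where `ℤ/p` is discrete. -/

namespace ProfiniteCohomology

universe u

section Cochains

variable (p : ℕ) (G : Type*) [Group G] [TopologicalSpace G]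

/-- Continuous inhomogeneous `n`-cochains of `G` with values in the discrete group `ℤ/p`. -/
abbrev Cochain (n : ℕ) : Type _ := C(Fin n → G, ZMod p)

variable {p G}

/-- Cup product of cochains, for the multiplication `ℤ/p × ℤ/p → ℤ/p`:
`(f ∪ g)(x₁, …, x_{a+b}) = f(x₁, …, x_a) g(x_{a+1}, …, x_{a+b})`. -/
def Cochain.cup {a b c : ℕ} (h : a + b = c) (f : Cochain p G a) (g : Cochain p G b) :
    Cochain p G c where
  toFun x := f (fun i => x ⟨i, by omega⟩) * g (fun i => x ⟨a + i, by omega⟩)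
  continuous_toFun := by fun_prop

variable [IsTopologicalGroup G]

theorem continuous_contractNth {n : ℕ} (j : Fin (n + 1)) :
    Continuous fun x : Fin (n + 1) → G => Fin.contractNth j (· * ·) x := by
  refine continuous_pi fun k => ?_
  unfold Fin.contractNth
  split_ifs <;> fun_prop

variable (p G) in
/-- The differential of the inhomogeneous cochain complex (trivial action on `ℤ/p`):
`(df)(x₁, …, x_{n+1}) = f(x₂, …, x_{n+1}) + ∑_{j=1}^{n} (-1)^j f(x₁, …, x_j x_{j+1}, …, x_{n+1})
  + (-1)^{n+1} f(x₁, …, x_n)`;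
`Fin.contractNth j` multiplies the entries `j` and `j + 1` (counted from `0`) and, for the
last `j`, drops the last entry. -/
def d (n : ℕ) : Cochain p G n →ₗ[ZMod p] Cochain p G (n + 1) where
  toFun f :=
    { toFun := fun x => f (fun i => x i.succ) +
        ∑ j : Fin (n + 1), (-1 : ZMod p) ^ ((j : ℕ) + 1) * f (Fin.contractNth j (· * ·) x)
      continuous_toFun := by
        have := fun j : Fin (n + 1) => continuous_contractNth (G := G) j
        fun_prop }
  map_add' f g := by
    ext x
    simp [mul_add, Finset.sum_add_distrib]
    ring
  map_smul' r f := by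
    ext x
    simp [mul_add, Finset.mul_sum, mul_left_comm]

variable (p G) in
/-- The `n`-cocycles. -/
def cocycles (n : ℕ) : Submodule (ZMod p) (Cochain p G n) := LinearMap.ker (d p G n)

variable (p G) in
/-- The `n`-coboundaries (zero for `n = 0`). -/
def coboundaries : (n : ℕ) → Submodule (ZMod p) (Cochain p G n)
  | 0 => ⊥
  | n + 1 => LinearMap.range (d p G n)

variable (p G) in
/-- The cohomology group `H^n(G) = H^n(G, ℤ/p)`, an `𝔽_p`-vector space. -/
abbrev H (n : ℕ) : Type _ :=
  cocycles p G n ⧸ (coboundaries p G n).submoduleOf (cocycles p G n)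

/-- `d ∘ d = 0`; the differential is the one of Mathlib's complex of inhomogeneous cochains of the
trivial representation, restricted to continuous cochains. -/
theorem d_comp_d {p : ℕ} {G : Type u} [Group G] [TopologicalSpace G] [IsTopologicalGroup G] (n : ℕ)
    (f : Cochain p G n) : d p G (n + 1) (d p G n f) = 0 := by
  let k := ULift.{u} (ZMod p)
  let A : Rep k G := Rep.trivial k G k
  have h := groupCohomology.inhomogeneousCochains.d_comp_d (k := k) (A := A) n
  let f' : (Fin n → G) → A := fun x => (ULift.up (f x) : k)
  have h' := congrArg (fun φ => φ.hom f') h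
  ext x
  have h'' := congrArg (ULift.ringEquiv (R := ZMod p)) (congrFun h' x)
  simp [inhomogeneousCochains.d_hom_apply] at h''
  simp only [d, LinearMap.coe_mk, AddHom.coe_mk, ContinuousMap.coe_mk, ContinuousMap.zero_apply]
  exact h''

theorem coboundaries_le_cocycles (n : ℕ) : coboundaries p G n ≤ cocycles p G n := by
  cases n with
  | zero => exact bot_le
  | succ n =>
    rintro _ ⟨f, rfl⟩
    exact d_comp_d n f

/-- The Leibniz rule `d(f ∪ g) = df ∪ g + (-1)^a f ∪ dg`. -/
theorem d_cup {a b c : ℕ} (h : a + b = c) (f : Cochain p G a) (g : Cochain p G b) :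
    d p G c (f.cup h g) = (d p G a f).cup (by omega : a + 1 + b = c + 1) g +
      (-1 : ZMod p) ^ a • f.cup (by omega : a + (b + 1) = c + 1) (d p G b g) := by
  subst h
  ext x
  have h1 : ∀ j : Fin a, f.cup rfl g (Fin.contractNth (Fin.castAdd (b + 1) j) (· * ·) x) =
      f (Fin.contractNth j.castSucc (· * ·) fun i : Fin (a + 1) => x ⟨i, by omega⟩) *
        g (fun i => x ⟨a + 1 + i, by omega⟩) := by
    intro j
    change f _ * g _ = _
    congr 2
    ext i
    have h2 : ¬ (a + (i : ℕ) < j) := by omega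
    have h3 : ¬ (a + (i : ℕ) = j) := by omega
    simp only [Fin.contractNth, Fin.val_castAdd, h2, h3, if_false]
    congr 1
    ext
    simp
    omega
  have h2 : ∀ j : Fin (b + 1), f.cup rfl g (Fin.contractNth (Fin.natAdd a j) (· * ·) x) =
      f (fun i => x ⟨i, by omega⟩) *
        g (Fin.contractNth j (· * ·) fun i : Fin (b + 1) => x ⟨a + i, by omega⟩) := by
    intro j
    change f _ * g _ = _
    congr 2
    · ext i
      have h2 : (i : ℕ) < a + j := by omega
      simp only [Fin.contractNth, Fin.val_natAdd, h2, if_true]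
      rfl
    · ext i
      simp only [Fin.contractNth, Fin.val_natAdd, add_lt_add_iff_left, add_right_inj]
      rfl
  have h3 : Fin.contractNth (Fin.last a) (· * ·) (fun i : Fin (a + 1) => x ⟨i, by omega⟩) =
      fun i : Fin a => x ⟨i, by omega⟩ := by
    ext i
    simp [Fin.contractNth]
  have h4 : d p G (a + b) (f.cup rfl g) x =
      f (fun i => x ⟨i + 1, by omega⟩) * g (fun i => x ⟨a + 1 + i, by omega⟩) +
      ((∑ j : Fin a, (-1 : ZMod p) ^ ((j : ℕ) + 1) *
        f.cup rfl g (Fin.contractNth (Fin.castAdd (b + 1) j) (· * ·) x)) +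
      ∑ j : Fin (b + 1), (-1 : ZMod p) ^ (a + (j : ℕ) + 1) *
        f.cup rfl g (Fin.contractNth (Fin.natAdd a j) (· * ·) x)) := by
    have h5 : d p G (a + b) (f.cup rfl g) x = f.cup rfl g (fun i => x i.succ) +
      ∑ j : Fin (a + (b + 1)), (-1 : ZMod p) ^ ((j : ℕ) + 1) *
        f.cup rfl g (Fin.contractNth j (· * ·) x) := rfl
    rw [h5, Fin.sum_univ_add]
    congr 1
    refine congrArg₂ (· * ·) rfl (congrArg g (funext fun i => congrArg x (Fin.ext ?_)))
    change a + (i : ℕ) + 1 = a + 1 + i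
    omega
  have h6 : (d p G a f).cup (by omega : a + 1 + b = a + b + 1) g x =
      (f (fun i => x ⟨i + 1, by omega⟩) + ∑ j : Fin (a + 1), (-1 : ZMod p) ^ ((j : ℕ) + 1) *
        f (Fin.contractNth j (· * ·) fun i : Fin (a + 1) => x ⟨i, by omega⟩)) *
      g (fun i => x ⟨a + 1 + i, by omega⟩) := rfl
  have h7 : f.cup (by omega : a + (b + 1) = a + b + 1) (d p G b g) x =
      f (fun i => x ⟨i, by omega⟩) *
      (g (fun i => x ⟨a + (i + 1), by omega⟩) + ∑ j : Fin (b + 1), (-1 : ZMod p) ^ ((j : ℕ) + 1) *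
        g (Fin.contractNth j (· * ·) fun i : Fin (b + 1) => x ⟨a + i, by omega⟩)) := rfl
  have h8 : (fun i : Fin b => x ⟨a + (i + 1), by omega⟩) =
      fun i : Fin b => x ⟨a + 1 + i, by omega⟩ := by
    ext i
    congr 2
    omega
  rw [h4, ContinuousMap.add_apply, ContinuousMap.smul_apply, h6, h7, Fin.sum_univ_castSucc (n := a), h3, h8]
  simp only [h1, h2, smul_eq_mul, Fin.val_castSucc, Fin.val_last]
  have h9 : ∑ j : Fin (b + 1), (-1 : ZMod p) ^ (a + (j : ℕ) + 1) *
      (f (fun i => x ⟨i, by omega⟩) *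
        g (Fin.contractNth j (· * ·) fun i : Fin (b + 1) => x ⟨a + i, by omega⟩)) =
      (-1 : ZMod p) ^ a * (f (fun i => x ⟨i, by omega⟩) *
        ∑ j : Fin (b + 1), (-1 : ZMod p) ^ ((j : ℕ) + 1) *
          g (Fin.contractNth j (· * ·) fun i : Fin (b + 1) => x ⟨a + i, by omega⟩)) := by
    simp only [Finset.mul_sum]
    refine Finset.sum_congr rfl fun j _ => ?_
    ring
  rw [h9]
  simp only [← mul_assoc, ← Finset.sum_mul]
  ring

theorem cup_mem_coboundaries_left {a b c : ℕ} (h : a + b = c) {f : Cochain p G a}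
    {g : Cochain p G b} (hf : f ∈ coboundaries p G a) (hg : g ∈ cocycles p G b) :
    f.cup h g ∈ coboundaries p G c := by
  have hg' : d p G b g = 0 := hg
  cases a with
  | zero =>
    have hf' : f = 0 := hf
    have h0 : f.cup h g = 0 := by
      ext x
      simp [hf', Cochain.cup]
    rw [h0]
    exact zero_mem _
  | succ a =>
    obtain ⟨e, rfl⟩ := hf
    obtain rfl : a + b + 1 = c := by omega
    refine ⟨e.cup rfl g, ?_⟩
    rw [d_cup, hg']
    ext x
    simp [Cochain.cup]

theorem cup_mem_coboundaries_right {a b c : ℕ} (h : a + b = c) {f : Cochain p G a}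
    {g : Cochain p G b} (hf : f ∈ cocycles p G a) (hg : g ∈ coboundaries p G b) :
    f.cup h g ∈ coboundaries p G c := by
  have hf' : d p G a f = 0 := hf
  cases b with
  | zero =>
    have hg' : g = 0 := hg
    have h0 : f.cup h g = 0 := by
      ext x
      simp [hg', Cochain.cup]
    rw [h0]
    exact zero_mem _
  | succ b =>
    obtain ⟨e, rfl⟩ := hg
    obtain rfl : a + b + 1 = c := by omega
    refine ⟨(-1 : ZMod p) ^ a • f.cup rfl e, ?_⟩
    rw [map_smul, d_cup, hf', smul_add, smul_smul, ← mul_pow]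
    ext x
    simp [Cochain.cup]

theorem cup_mem_cocycles {a b c : ℕ} (h : a + b = c) {f : Cochain p G a}
    {g : Cochain p G b} (hf : f ∈ cocycles p G a) (hg : g ∈ cocycles p G b) :
    f.cup h g ∈ cocycles p G c := by
  have hf' : d p G a f = 0 := hf
  have hg' : d p G b g = 0 := hg
  change d p G c (f.cup h g) = 0
  rw [d_cup, hf', hg']
  ext x
  simp [Cochain.cup]

/-- The cup product of cocycles, with values in cohomology. -/
def cupCocycles {a b c : ℕ} (h : a + b = c) :
    cocycles p G a →ₗ[ZMod p] cocycles p G b →ₗ[ZMod p] H p G c :=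
  LinearMap.mk₂ (ZMod p)
    (fun f g => Submodule.Quotient.mk ⟨f.1.cup h g.1, cup_mem_cocycles h f.2 g.2⟩)
    (fun f f' g => by
      rw [← Submodule.Quotient.mk_add]
      congr 1
      ext x
      simp [Cochain.cup, add_mul])
    (fun r f g => by
      rw [← Submodule.Quotient.mk_smul]
      congr 1
      ext x
      simp [Cochain.cup, mul_assoc])
    (fun f g g' => by
      rw [← Submodule.Quotient.mk_add]
      congr 1
      ext x
      simp [Cochain.cup, mul_add])
    (fun r f g => by
      rw [← Submodule.Quotient.mk_smul]
      congr 1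
      ext x
      simp [Cochain.cup, mul_left_comm])

/-- The cup product `∪ : H^a(G) × H^b(G) → H^c(G)`, where `a + b = c`. -/
def cup {a b c : ℕ} (h : a + b = c) : H p G a →ₗ[ZMod p] H p G b →ₗ[ZMod p] H p G c :=
  (Submodule.liftQ _
    (Submodule.liftQ _ (cupCocycles h) (fun f hf => by
      ext g
      exact (Submodule.Quotient.mk_eq_zero _).2
        (cup_mem_coboundaries_left h hf g.2))).flip
    (fun g hg => by
      ext f
      exact (Submodule.Quotient.mk_eq_zero _).2
        (cup_mem_coboundaries_right h f.2 hg))).flip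

/-- `x ∪ β₁ ∪ ⋯ ∪ β_j` for `x ∈ H^k(G)` and `β₁, …, β_j ∈ H^1(G)`, as a linear map in `x`. -/
def iteratedCup {k : ℕ} : (j : ℕ) → (Fin j → H p G 1) → H p G k →ₗ[ZMod p] H p G (k + j)
  | 0, _ => LinearMap.id
  | j + 1, β => (cup (Nat.add_assoc k j 1)).flip (β (Fin.last j)) ∘ₗ iteratedCup j (Fin.init β)

variable (p G) in
/-- Identification of `H^a(G)` and `H^b(G)` for equal degrees `a = b`. -/
def degreeCast {a b : ℕ} (h : a = b) : H p G a ≃ₗ[ZMod p] H p G b :=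
  h ▸ LinearEquiv.refl (ZMod p) (H p G a)

end Cochains

section Functoriality

variable {p : ℕ} {G G' : Type*} [Group G] [TopologicalSpace G] [Group G'] [TopologicalSpace G']

variable (p) in
/-- Pullback of cochains along a continuous homomorphism. -/
def Cochain.pullback (φ : G →ₜ* G') (n : ℕ) : Cochain p G' n →ₗ[ZMod p] Cochain p G n where
  toFun f := ⟨fun x => f (fun i => φ (x i)), by fun_prop⟩
  map_add' _ _ := rfl
  map_smul' _ _ := rfl

variable [IsTopologicalGroup G] [IsTopologicalGroup G']

theorem d_pullback (φ : G →ₜ* G') (n : ℕ) (f : Cochain p G' n) :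
    d p G n (Cochain.pullback p φ n f) = Cochain.pullback p φ (n + 1) (d p G' n f) := by
  ext x
  have h (j : Fin (n + 1)) : (fun i => φ (Fin.contractNth j (· * ·) x i)) =
      Fin.contractNth j (· * ·) fun i => φ (x i) :=
    Fin.comp_contractNth (f := φ) _ _ (map_mul φ) j x
  simp [d, Cochain.pullback, h]

variable (p) in
/-- The map `H^n(G') → H^n(G)` induced by a continuous homomorphism `φ : G → G'`: inflation if
`φ` is a quotient map, restriction if `φ` is the inclusion of a subgroup. -/
def map (φ : G →ₜ* G') (n : ℕ) : H p G' n →ₗ[ZMod p] H p G n :=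
  Submodule.mapQ _ _
    ((Cochain.pullback p φ n).restrict (p := cocycles p G' n) (q := cocycles p G n) (fun f hf => by
      have hf' : d p G' n f = 0 := hf
      change d p G n _ = 0
      rw [d_pullback, hf', map_zero]))
    (fun f hf => by
      have hf' : f.1 ∈ coboundaries p G' n := hf
      change Cochain.pullback p φ n f.1 ∈ coboundaries p G n
      cases n with
      | zero =>
        have h0 : f.1 = 0 := hf'
        rw [h0, map_zero]
        exact zero_mem _
      | succ n =>
        obtain ⟨e, he⟩ := hf'
        exact ⟨Cochain.pullback p φ n e, by rw [d_pullback, he]⟩)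

end Functoriality

end ProfiniteCohomology

/-! ## Cyclotomic pro-`p` pairs and their extensions -/

/-- The group `1 + pℤ_p` of `1`-units of `ℤ_p`. -/
def oneUnits (p : ℕ) [Fact p.Prime] : Subgroup ℤ_[p]ˣ where
  carrier := {u | (p : ℤ_[p]) ∣ (u : ℤ_[p]) - 1}
  one_mem' := by simp
  mul_mem' {u v} hu hv := by
    have h : ((u * v : ℤ_[p]ˣ) : ℤ_[p]) - 1 = u * (v - 1) + (u - 1) := by
      push_cast
      ring
    change (p : ℤ_[p]) ∣ ((u * v : ℤ_[p]ˣ) : ℤ_[p]) - 1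
    rw [h]
    exact dvd_add (Dvd.dvd.mul_left hv _) hu
  inv_mem' {u} hu := by
    have h : ((u⁻¹ : ℤ_[p]ˣ) : ℤ_[p]) - 1 = -(u⁻¹ : ℤ_[p]ˣ) * (u - 1) := by
      rw [mul_sub, neg_mul, Units.inv_mul]
      ring
    change (p : ℤ_[p]) ∣ ((u⁻¹ : ℤ_[p]ˣ) : ℤ_[p]) - 1
    rw [h]
    exact Dvd.dvd.mul_left hu _

/-- A pro-`p` group: a profinite group all of whose quotients by open normal subgroups are
(finite) `p`-groups. -/
structure IsProP (p : ℕ) (G : Type*) [Group G] [TopologicalSpace G] [IsTopologicalGroup G] :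
    Prop where
  compactSpace : CompactSpace G
  totallyDisconnectedSpace : TotallyDisconnectedSpace G
  isPGroup_quotient : ∀ U : Subgroup G, ∀ _ : U.Normal, IsOpen (U : Set G) → IsPGroup p (G ⧸ U)

/-- A cyclotomic pro-`p` pair `(G, θ)`: a pro-`p` group `G` with a continuous homomorphism
`θ : G → 1 + pℤ_p`. -/
structure CyclotomicPair (p : ℕ) [Fact p.Prime] (G : Type*) [Group G] [TopologicalSpace G]
    [IsTopologicalGroup G] where
  isProP : IsProP p G
  θ : G →ₜ* oneUnits p

namespace SemidirectProduct

variable {N G : Type*} [Group N] [Group G] {φ : G →* MulAut N}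
  [TopologicalSpace N] [TopologicalSpace G]

/-- The topology of a semidirect product is the product topology of `N × G`. -/
instance : TopologicalSpace (N ⋊[φ] G) :=
  TopologicalSpace.induced (fun x => (x.left, x.right)) inferInstance

theorem continuous_left_right : Continuous fun x : N ⋊[φ] G => (x.left, x.right) :=
  continuous_induced_dom

theorem isTopologicalGroup_of_continuous [IsTopologicalGroup N] [IsTopologicalGroup G]
    (hφ : Continuous fun x : G × N => φ x.1 x.2) : IsTopologicalGroup (N ⋊[φ] G) where
  continuous_mul := by
    have hl : Continuous fun x : N ⋊[φ] G => x.left := continuous_left_right.fst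
    have hr : Continuous fun x : N ⋊[φ] G => x.right := continuous_left_right.snd
    refine continuous_induced_rng.2 (Continuous.prodMk ?_ ?_)
    · exact (hl.comp continuous_fst).mul
        (hφ.comp ((hr.comp continuous_fst).prodMk (hl.comp continuous_snd)))
    · exact (hr.comp continuous_fst).mul (hr.comp continuous_snd)
  continuous_inv := by
    have hl : Continuous fun x : N ⋊[φ] G => x.left := continuous_left_right.fst
    have hr : Continuous fun x : N ⋊[φ] G => x.right := continuous_left_right.snd
    exact continuous_induced_rng.2 (Continuous.prodMk (hφ.comp (hr.inv.prodMk hl.inv)) hr.inv)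

variable (φ) in
/-- The projection `N ⋊ G → G`. -/
def rightHomₜ : N ⋊[φ] G →ₜ* G := ⟨rightHom, continuous_left_right.snd⟩

variable (φ) in
/-- The inclusion `N → N ⋊ G`. -/
def inlₜ : N →ₜ* N ⋊[φ] G :=
  ⟨inl, continuous_induced_rng.2 (continuous_id.prodMk continuous_const)⟩

variable (φ) in
/-- The inclusion `G → N ⋊ G`. -/
def inrₜ : G →ₜ* N ⋊[φ] G :=
  ⟨inr, continuous_induced_rng.2 (continuous_const.prodMk continuous_id)⟩

end SemidirectProduct

/-- The free abelian pro-`p` group `ℤ_p^m`, `m` the cardinality of `ι`: the direct power with the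
product topology, written multiplicatively as a group. -/
abbrev FreeAbelianProP (p : ℕ) [Fact p.Prime] (ι : Type*) : Type _ := Multiplicative (ι → ℤ_[p])

namespace CyclotomicPair

variable {p : ℕ} [Fact p.Prime] {G : Type*} [Group G] [TopologicalSpace G] [IsTopologicalGroup G]

/-- The action of `G` on `ℤ_p^m` by `g • a = θ(g) a`. -/
def action (P : CyclotomicPair p G) (ι : Type*) : G →* MulAut (FreeAbelianProP p ι) where
  toFun g := AddEquiv.toMultiplicative
    (DistribMulAction.toAddEquiv (ι → ℤ_[p]) (P.θ g : ℤ_[p]ˣ))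
  map_one' := by
    ext a
    simp
  map_mul' g h := by
    ext a
    simp [mul_smul]

theorem action_apply (P : CyclotomicPair p G) (ι : Type*) (g : G) (a : ι → ℤ_[p]) :
    P.action ι g (Multiplicative.ofAdd a) =
      Multiplicative.ofAdd (((P.θ g : ℤ_[p]ˣ) : ℤ_[p]) • a) := rfl

/-- The underlying group `ℤ_p^m ⋊ G` of the extension of the pair `(G, θ)` by `ℤ_p^m`. -/
abbrev Extension (P : CyclotomicPair p G) (ι : Type*) : Type _ :=
  FreeAbelianProP p ι ⋊[P.action ι] G

instance (P : CyclotomicPair p G) (ι : Type*) :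
    IsTopologicalGroup (P.Extension ι) := by
  refine SemidirectProduct.isTopologicalGroup_of_continuous ?_
  have h : Continuous fun x : G × (ι → ℤ_[p]) => ((P.θ x.1 : ℤ_[p]ˣ) : ℤ_[p]) • x.2 :=
    (Units.continuous_val.comp (continuous_subtype_val.comp
      (P.θ.continuous_toFun.comp continuous_fst))).smul continuous_snd
  exact h

/-- The map `H^{i-j}(Ḡ) → H^i(G)`, `x ↦ inf(x) ∪ β₁ ∪ ⋯ ∪ β_j`, where `G = ℤ_p^m ⋊ Ḡ`, `j ≤ i` and
`β₁, …, β_j ∈ H^1(G)`. -/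
def infCup {Gbar : Type*} [Group Gbar] [TopologicalSpace Gbar] [IsTopologicalGroup Gbar]
    (P : CyclotomicPair p Gbar) (ι : Type*) {i j : ℕ} (hj : j ≤ i)
    (β : Fin j → ProfiniteCohomology.H p (P.Extension ι) 1) :
    ProfiniteCohomology.H p Gbar (i - j) →ₗ[ZMod p] ProfiniteCohomology.H p (P.Extension ι) i :=
  (ProfiniteCohomology.degreeCast p (P.Extension ι) (Nat.sub_add_cancel hj)).toLinearMap ∘ₗ
    ProfiniteCohomology.iteratedCup j β ∘ₗ
      ProfiniteCohomology.map p (SemidirectProduct.rightHomₜ (P.action ι)) (i - j)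

end CyclotomicPair

end

/-! Suppose first that `G → Q` forgets one coordinate of `A`: its kernel is `ℤ_p`, it has a
continuous section, and some `β ∈ H^1(G)` takes the value `1` on the generator `γ` of the kernel.
The cohomology of `ℤ_p` is `𝔽_p` in degree `0`, `𝔽_p β` in degree `1`, and zero above.
Hochschild–Serre thus has two rows, and since `β` lives on all of `G` the sequence splits:
`H^{n+1}(G) = inf H^{n+1}(Q) ⊕ inf H^n(Q) ∪ β`. This is `gysin_bijective`.

No spectral sequence is used. The claim says that the cone of `(f, g) ↦ inf f + inf g ∪ β` is exact
(`cone_exact`). The cone is resolved by cones of cochains with an extra parameter in `Q^a`. The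
direction of `a` is exact because the extra parameter can be set to the image of the first argument.
For `a ≥ 1` the parameter space maps equivariantly to `Q`, so, as in Shapiro's lemma, cochains of
`Q` become acyclic and cochains of `G` compute the cohomology of the kernel. `exact_of_exact_rows`
then transfers exactness to `a = 0`. The analytic input is that `F(z + 1) - F(z) = f(z)` is solvable
for continuous `f : ℤ_p → ℤ/p`, with only constants as ambiguity.

Adjoining coordinates in increasing order gives the theorem for `ℤ_p^S ⋊ Ḡ` with `S` finite. A
continuous cochain on a compact group depends on finitely many coordinates of `A`, so every class
comes from some finite `S` (`Decomposes.of_forall_finset`). The induction carries `Decomposes`: a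
spanning statement and, for each index, a linear retraction killing all other summands. The
retractions yield directness and injectivity at once and survive both the induction step and the
limit.

For general `β_l`, one uses that `H^1(ℤ_p^ι)` consists of finitely supported functions on `ι`. A
basis of it lifts to an isomorphism `ℤ_p^ι ≃ ℤ_p^L` under which `β_l` becomes the `l`-th coordinate
modulo `p` (`exists_equiv_coordCocycle`). Since `θ ≡ 1` modulo `p`, such coordinates are
homomorphisms on the whole semidirect product. -/

noncomputable section

set_option linter.unusedSectionVars false

namespace ProfiniteCohomology

/-! ## The Čech differential -/

section Cech

variable {V M : Type*} [AddCommGroup M]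

/-- The alternating sum over the omissions of one argument. -/
def cechD (n : ℕ) : ((Fin n → V) → M) →+ ((Fin (n + 1) → V) → M) where
  toFun F h := ∑ j : Fin (n + 1), (-1 : ℤ) ^ (j : ℕ) • F (j.removeNth h)
  map_zero' := by
    ext h
    simp
  map_add' F F' := by
    ext h
    simp [Finset.sum_add_distrib]

theorem cechD_def (n : ℕ) (F : (Fin n → V) → M) (h : Fin (n + 1) → V) :
    cechD n F h = ∑ j : Fin (n + 1), (-1 : ℤ) ^ (j : ℕ) • F (j.removeNth h) := rfl

theorem cechD_zero (F : (Fin 0 → V) → M) (h : Fin 1 → V) : cechD 0 F h = F Fin.elim0 := by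
  rw [cechD_def]
  simp
  congr 1
  exact Subsingleton.elim _ _

theorem removeNth_succ_cons {n : ℕ} (j : Fin (n + 1)) (v : V) (h : Fin (n + 1) → V) :
    j.succ.removeNth (Fin.cons v h : Fin (n + 2) → V) = Fin.cons v (j.removeNth h) := by
  funext i
  refine Fin.cases ?_ (fun i => ?_) i <;> simp [Fin.removeNth]

/-- Splitting off the omission of the first argument gives a recursion that replaces sign
bookkeeping in the later inductions. -/
theorem cechD_cons {n : ℕ} (F : (Fin (n + 1) → V) → M) (v : V) (h : Fin (n + 1) → V) :
    cechD (n + 1) F (Fin.cons v h : Fin (n + 2) → V) =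
      F h - cechD n (fun h' => F (Fin.cons v h' : Fin (n + 1) → V)) h := by
  rw [cechD_def, Fin.sum_univ_succ, cechD_def, sub_eq_add_neg, ← Finset.sum_neg_distrib]
  congr 1
  · simp
  · refine Finset.sum_congr rfl fun j _ => ?_
    rw [removeNth_succ_cons, Fin.val_succ, pow_succ, mul_neg_one, neg_smul]

theorem cechD_cechD {n : ℕ} (F : (Fin n → V) → M) : cechD (n + 1) (cechD n F) = 0 := by
  induction n with
  | zero =>
    funext h
    rw [← Fin.cons_self_tail h, cechD_cons, cechD_zero, cechD_zero, cechD_zero, sub_self]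
    rfl
  | succ n ih =>
    funext h
    rw [← Fin.cons_self_tail h, cechD_cons]
    have : (fun h' => cechD (n + 1) F (Fin.cons (h 0) h' : Fin (n + 2) → V)) =
        F - cechD n (fun h' => F (Fin.cons (h 0) h' : Fin (n + 1) → V)) :=
      funext fun h' => cechD_cons _ _ _
    rw [this, map_sub, ih, sub_zero, sub_self]
    rfl

/-- Inserting a fixed first argument is a contracting homotopy. Exactness questions thereby reduce
to choosing `v` equivariantly and continuously. -/
theorem eq_cechD_of_closed {n : ℕ} {F : (Fin (n + 1) → V) → M} (hF : cechD (n + 1) F = 0) (v : V)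
    (h : Fin (n + 1) → V) : F h = cechD n (fun h' => F (Fin.cons v h' : Fin (n + 1) → V)) h := by
  have := congrFun hF (Fin.cons v h : Fin (n + 2) → V)
  rw [cechD_cons] at this
  exact sub_eq_zero.1 this

theorem cechD_apply {X : Type*} {n : ℕ} (F : (Fin n → V) → X → M) (h : Fin (n + 1) → V) (x : X) :
    cechD n F h x = cechD n (fun h' => F h' x) h := by
  simp [cechD_def]

theorem cechD_one (F : (Fin 1 → V) → M) (h : Fin 2 → V) :
    cechD 1 F h = F (fun _ => h 1) - F (fun _ => h 0) := by
  rw [← Fin.cons_self_tail h, cechD_cons, cechD_zero]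
  congr 2 <;> · funext i; fin_cases i; rfl

end Cech

/-! ## A diagram chase -/

section Chase

variable {K : ℕ → ℕ → Type*} {E : ℕ → Type*} [∀ a b, AddCommGroup (K a b)]
  [∀ a, AddCommGroup (E a)]

/-- In a double complex `E → K₀ → K₁ → ⋯` with exact rows (in the direction of the first index) and
columns that are exact in positive degrees, the zeroth column is exact. -/
theorem exact_of_exact_rows (dh : ∀ a b, K a b →+ K (a + 1) b) (dv : ∀ a b, K a b →+ K a (b + 1))
    (dE : ∀ a, E a →+ E (a + 1)) (ε : ∀ a, E a →+ K a 0)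
    (I : ∀ a b, AddSubgroup (K a b)) (J : ∀ a, AddSubgroup (E a))
    (hdhI : ∀ a b, ∀ x ∈ I a b, dh a b x ∈ I (a + 1) b)
    (hdvI : ∀ a b, ∀ x ∈ I a b, dv a b x ∈ I a (b + 1))
    (hdE : ∀ a, ∀ x ∈ J a, dE a x ∈ J (a + 1))
    (hε : ∀ a, ∀ x ∈ J a, ε a x ∈ I a 0)
    (comm : ∀ a b x, dh a (b + 1) (dv a b x) = dv (a + 1) b (dh a b x))
    (commE : ∀ a x, dh a 0 (ε a x) = ε (a + 1) (dE a x))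
    (dvdv : ∀ a b x, dv a (b + 1) (dv a b x) = 0)
    (dvε : ∀ a x, dv a 0 (ε a x) = 0)
    (dhdh : ∀ a b x, dh (a + 1) b (dh a b x) = 0)
    (row0 : ∀ b, ∀ x ∈ I 0 b, dh 0 b x = 0 → x = 0)
    (row : ∀ a b, ∀ x ∈ I (a + 1) b, dh (a + 1) b x = 0 → ∃ y ∈ I a b, dh a b y = x)
    (rowE : ∀ a, ∀ x ∈ J (a + 1), dE (a + 1) x = 0 → ∃ y ∈ J a, dE a y = x)
    (colE : ∀ a, ∀ x ∈ J (a + 1), ε (a + 1) x = 0 → x = 0)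
    (col0 : ∀ a, ∀ x ∈ I (a + 1) 0, dv (a + 1) 0 x = 0 → ∃ y ∈ J (a + 1), ε (a + 1) y = x)
    (col : ∀ a b, ∀ x ∈ I (a + 1) (b + 1), dv (a + 1) (b + 1) x = 0 →
      ∃ y ∈ I (a + 1) b, dv (a + 1) b y = x) :
    (∀ x ∈ I 0 0, dv 0 0 x = 0 → ∃ y ∈ J 0, ε 0 y = x) ∧
      ∀ b, ∀ x ∈ I 0 (b + 1), dv 0 (b + 1) x = 0 → ∃ y ∈ I 0 b, dv 0 b y = x := by
  -- Column `a + 1` writes `dh x` as `ε y`; injectivity of `ε` there makes `y` closed, so row `E`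
  -- provides `w`.
  have key0 : ∀ a, ∀ x ∈ I a 0, dh a 1 (dv a 0 x) = 0 → ∃ w ∈ J a, dh a 0 x = dh a 0 (ε a w) := by
    intro a x hx h
    obtain ⟨y, hy, hyx⟩ := col0 a (dh a 0 x) (hdhI _ _ _ hx) (by rw [← comm, h])
    obtain ⟨w, hw, hwy⟩ := rowE a y hy (by
      apply colE (a + 1) _ (hdE _ _ hy)
      rw [← commE, hyx, dhdh])
    exact ⟨w, hw, by rw [commE, hwy, hyx]⟩
  -- Assuming only that `dh (dv x)` vanishes, rather than `dv x`, lets the induction apply in column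
  -- `a + 1` to a `y` with `dv y = dh x`.
  have key : ∀ b a, ∀ x ∈ I a (b + 1), dh a (b + 1 + 1) (dv a (b + 1) x) = 0 →
      ∃ w ∈ I a b, dh a (b + 1) x = dh a (b + 1) (dv a b w) := by
    intro b
    induction b with
    | zero =>
      intro a x hx h
      obtain ⟨y, hy, hyx⟩ := col a 0 (dh a 1 x) (hdhI _ _ _ hx) (by rw [← comm, h])
      obtain ⟨w', hw', hyw⟩ := key0 (a + 1) y hy (by rw [hyx, dhdh])
      obtain ⟨w, hw, hwy⟩ := row a 0 (y - ε (a + 1) w') (sub_mem hy (hε _ _ hw')) (by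
        rw [map_sub, hyw, sub_self])
      refine ⟨w, hw, ?_⟩
      rw [comm, hwy, map_sub, dvε, sub_zero, hyx]
    | succ b ih =>
      intro a x hx h
      obtain ⟨y, hy, hyx⟩ := col a (b + 1) (dh a (b + 2) x) (hdhI _ _ _ hx) (by rw [← comm, h])
      obtain ⟨w', hw', hyw⟩ := ih (a + 1) y hy (by rw [hyx, dhdh])
      obtain ⟨w, hw, hwy⟩ := row a (b + 1) (y - dv (a + 1) b w') (sub_mem hy (hdvI _ _ _ hw')) (by
        rw [map_sub, hyw, sub_self])
      refine ⟨w, hw, ?_⟩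
      rw [comm, hwy, map_sub, dvdv, sub_zero, hyx]
  constructor
  · intro x hx h
    obtain ⟨w, hw, h'⟩ := key0 0 x hx (by rw [h, map_zero])
    refine ⟨w, hw, (sub_eq_zero.1 (row0 0 _ (sub_mem hx (hε _ _ hw)) ?_)).symm⟩
    rw [map_sub, h', sub_self]
  · intro b x hx h
    obtain ⟨w, hw, h'⟩ := key b 0 x hx (by rw [h, map_zero])
    refine ⟨w, hw, (sub_eq_zero.1 (row0 _ _ (sub_mem hx (hdvI _ _ _ hw)) ?_)).symm⟩
    rw [map_sub, h', sub_self]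

end Chase

/-! ## Difference equations on `ℤ_p` -/

section Difference

variable (p : ℕ) [Fact p.Prime]

theorem continuous_toZMod : Continuous (PadicInt.toZMod : ℤ_[p] → ZMod p) := by
  refine continuous_of_continuousAt_zero (PadicInt.toZMod : ℤ_[p] →+* ZMod p) ?_
  rw [ContinuousAt, map_zero, nhds_discrete (ZMod p), Filter.tendsto_pure]
  filter_upwards [Metric.ball_mem_nhds (0 : ℤ_[p]) one_pos] with x hx
  have : x ∈ RingHom.ker (PadicInt.toZMod : ℤ_[p] →+* ZMod p) := by
    rw [PadicInt.ker_toZMod, PadicInt.maximalIdeal_eq_span_p, Ideal.mem_span_singleton,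
      ← PadicInt.norm_lt_one_iff_dvd]
    simpa using hx
  exact this

variable {p}

theorem exists_pow_invariant (f : C(ℤ_[p], ZMod p)) :
    ∃ n : ℕ, ∀ x y : ℤ_[p], x - y ∈ Ideal.span {(p : ℤ_[p]) ^ n} → f x = f y := by
  -- Uniform continuity is applied to the real-valued representatives, where values at distance less
  -- than `1` coincide.
  have hc : Continuous fun z => ((f z).val : ℝ) :=
    (continuous_of_discreteTopology (f := fun a : ZMod p => (a.val : ℝ))).comp f.continuous
  obtain ⟨δ, hδ, h⟩ := Metric.uniformContinuous_iff.1
    (CompactSpace.uniformContinuous_of_continuous hc) 1 one_pos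
  obtain ⟨n, hn⟩ := PadicInt.exists_pow_neg_lt p hδ
  refine ⟨n, fun x y hxy => ?_⟩
  have h1 := @h x y (by
    rw [dist_eq_norm]
    exact ((PadicInt.norm_le_pow_iff_mem_span_pow _ _).2 hxy).trans_lt hn)
  refine ZMod.val_injective p ?_
  rw [Real.dist_eq] at h1
  have h2 : |((f x).val : ℤ) - (f y).val| < 1 := by exact_mod_cast h1
  have := Int.abs_lt_one_iff.1 h2
  omega

/-- If `f` has period `p ^ n`, its partial sums `s` change by the constant `s (p ^ n)` over each
period, hence have period `p ^ (n + 1)` modulo `p`. They therefore extend continuously to `ℤ_p`. -/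
theorem exists_difference_eq (f : C(ℤ_[p], ZMod p)) :
    ∃ F : C(ℤ_[p], ZMod p), ∀ z, F (z + 1) - F z = f z := by
  obtain ⟨n, hn⟩ := exists_pow_invariant f
  let s : ℕ → ZMod p := fun m => ∑ k ∈ Finset.range m, f k
  have hf : ∀ m k : ℕ, f ((m * p ^ n + k : ℕ) : ℤ_[p]) = f k := fun m k => hn _ _ <| by
    rw [Ideal.mem_span_singleton]
    exact ⟨m, by push_cast; ring⟩
  have hs1 : ∀ m k, s (m * p ^ n + k) = s (m * p ^ n) + s k := fun m k => by
    simp only [s, Finset.sum_range_add, hf]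
  have hs2 : ∀ m, s (m * p ^ n) = m * s (p ^ n) := fun m => by
    induction m with
    | zero => simp [s]
    | succ m ih => rw [add_mul, one_mul, hs1, ih]; push_cast; ring
  -- The extra power of `p` multiplies the sum over one period by `p`, which is zero in `ZMod p`.
  have hs3 : ∀ m, s (m % p ^ (n + 1)) = s m := fun m => by
    conv_rhs => rw [← Nat.div_add_mod m (p ^ (n + 1))]
    have : p ^ (n + 1) * (m / p ^ (n + 1)) = (p * (m / p ^ (n + 1))) * p ^ n := by ring
    rw [this, hs1, hs2]
    simp
  have : NeZero (p ^ (n + 1)) := ⟨pow_ne_zero _ (Fact.out : p.Prime).ne_zero⟩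
  have hcong : ∀ z : ℤ_[p], f ((PadicInt.toZModPow (n + 1) z).val : ℤ_[p]) = f z := fun z => by
    refine hn _ _ ?_
    have h1 : ((PadicInt.toZModPow (n + 1) z).val : ℤ_[p]) - z ∈
        RingHom.ker (PadicInt.toZModPow (p := p) (n + 1)) := by
      rw [RingHom.mem_ker, map_sub, map_natCast, ZMod.natCast_zmod_val, sub_self]
    rw [PadicInt.ker_toZModPow] at h1
    refine Ideal.span_singleton_le_span_singleton.2 ?_ h1
    exact pow_dvd_pow _ (Nat.le_succ n)
  have hcont : Continuous fun z : ℤ_[p] => s (PadicInt.toZModPow (n + 1) z).val := by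
    refine continuous_iff_continuousAt.2 fun z => ?_
    rw [ContinuousAt, nhds_discrete (ZMod p), Filter.tendsto_pure]
    filter_upwards [Metric.ball_mem_nhds z (ε := (p : ℝ) ^ (-(n + 1 : ℕ) : ℤ))
      (zpow_pos (by exact_mod_cast (Fact.out : p.Prime).pos) _)] with x hx
    congr 2
    rw [← sub_eq_zero, ← map_sub, ← RingHom.mem_ker, PadicInt.ker_toZModPow,
      ← PadicInt.norm_le_pow_iff_mem_span_pow]
    rw [Metric.mem_ball, dist_eq_norm] at hx
    exact hx.le
  refine ⟨⟨_, hcont⟩, fun z => ?_⟩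
  change s _ - s _ = _
  rw [map_add, map_one, ZMod.val_add, hs3, ← hcong z]
  by_cases h1 : p ^ (n + 1) = 1
  · have := (Fact.out : p.Prime).one_lt
    exact absurd h1 (Nat.one_lt_pow (Nat.succ_ne_zero n) this).ne'
  · have : Fact (1 < p ^ (n + 1)) := ⟨by have := NeZero.pos (p ^ (n + 1)); omega⟩
    rw [ZMod.val_one]
    simp only [s]
    rw [Finset.sum_range_succ, add_sub_cancel_left]

/-- Mapping a compact space into the open set `{0}` is an open condition in the compact-open
topology. Discreteness makes arbitrary choices in this function space continuous. -/
instance discreteTopology_continuousMap {X : Type*} [TopologicalSpace X] [CompactSpace X] :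
    DiscreteTopology C(X, ZMod p) := by
  refine discreteTopology_of_isOpen_singleton_zero ?_
  have : ({0} : Set C(X, ZMod p)) = {g : C(X, ZMod p) | Set.range g ⊆ {0}} := by
    ext g
    simp [DFunLike.ext_iff]
  rw [this]
  exact ContinuousMap.isOpen_setOfPred_range_subset (isOpen_discrete _)

/-- By currying, `f` is a continuous family of functions on `ℤ_p`. An arbitrary choice of solutions
preserves continuity because the function space is discrete. -/
theorem exists_difference_eq_of_prod {T : Type*} [TopologicalSpace T] (f : C(ℤ_[p] × T, ZMod p)) :
    ∃ F : C(ℤ_[p] × T, ZMod p), ∀ z t, F (z + 1, t) - F (z, t) = f (z, t) := by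
  choose S hS using exists_difference_eq (p := p)
  let f' : C(T, C(ℤ_[p], ZMod p)) := (f.comp ContinuousMap.prodSwap).curry
  let F' : C(T, C(ℤ_[p], ZMod p)) := ⟨fun t => S (f' t), continuous_of_discreteTopology.comp
    f'.continuous⟩
  exact ⟨F'.uncurry.comp ContinuousMap.prodSwap, fun z t => hS (f' t) z⟩

/-- The natural numbers are dense in `ℤ_p`. -/
theorem eq_of_difference_eq_zero {f : ℤ_[p] → ZMod p} (hf : Continuous f)
    (h : ∀ z, f (z + 1) = f z) (z : ℤ_[p]) : f z = f 0 := by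
  have : f = fun _ => f 0 := by
    refine PadicInt.denseRange_natCast.equalizer hf continuous_const ?_
    funext n
    induction n with
    | zero => simp
    | succ n ih => simpa [h] using ih
  exact congrFun this z

end Difference

/-! ## Homogeneous cochains with parameters -/

section Homogeneous

variable (p : ℕ) {G Q : Type*} [Group G] [TopologicalSpace G] [Group Q] [TopologicalSpace Q]
  (X : Type*) [TopologicalSpace X] [MulAction Q X]

/-- Homogeneous continuous cochains of `G` with a parameter in the `Q`-space `X`, on which `G` acts
through `π : G → Q`. -/
def homCochains (π : G →ₜ* Q) (n : ℕ) : AddSubgroup (X → (Fin n → G) → ZMod p) where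
  carrier := {F | (Continuous fun z : X × (Fin n → G) => F z.1 z.2) ∧
    ∀ (g : G) (x : X) (h : Fin n → G), F (π g • x) (g • h) = F x h}
  zero_mem' := ⟨continuous_const, fun _ _ _ => rfl⟩
  add_mem' hF hF' := ⟨hF.1.add hF'.1, fun g x h => congrArg₂ (· + ·) (hF.2 g x h) (hF'.2 g x h)⟩
  neg_mem' hF := ⟨hF.1.neg, fun g x h => congrArg Neg.neg (hF.2 g x h)⟩

variable {p} {X}

/-- The Čech differential with a parameter. -/
def cechX (X : Type*) (V : Type*) (n : ℕ) :
    (X → (Fin n → V) → ZMod p) →+ (X → (Fin (n + 1) → V) → ZMod p) where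
  toFun F x := cechD n (F x)
  map_zero' := funext fun _ => map_zero _
  map_add' _ _ := funext fun _ => map_add _ _ _

theorem cechX_apply {V : Type*} {n : ℕ} (F : X → (Fin n → V) → ZMod p) (x : X) :
    cechX X V n F x = cechD n (F x) := rfl

theorem cechX_cechX {V : Type*} {n : ℕ} (F : X → (Fin n → V) → ZMod p) :
    cechX X V (n + 1) (cechX X V n F) = 0 := funext fun _ => cechD_cechD _

theorem continuous_removeNth {V : Type*} [TopologicalSpace V] {n : ℕ} (j : Fin (n + 1)) :
    Continuous fun h : Fin (n + 1) → V => (j.removeNth h : Fin n → V) :=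
  continuous_pi fun i => continuous_apply (j.succAbove i)

theorem continuous_cons {Y V : Type*} [TopologicalSpace Y] [TopologicalSpace V] {n : ℕ}
    {f : Y → V} {g : Y → Fin n → V} (hf : Continuous f) (hg : Continuous g) :
    Continuous fun y => (Fin.cons (f y) (g y) : Fin (n + 1) → V) :=
  continuous_pi fun i => by
    refine Fin.cases ?_ (fun i => ?_) i
    · simpa using hf
    · simpa using! (continuous_apply i).comp hg

theorem smul_cons {n : ℕ} (g x : G) (h : Fin n → G) :
    (Fin.cons (g * x) (g • h) : Fin (n + 1) → G) = g • (Fin.cons x h : Fin (n + 1) → G) := by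
  funext i
  refine Fin.cases ?_ (fun i => ?_) i <;> simp

theorem continuous_cechD {Y V : Type*} [TopologicalSpace Y] [TopologicalSpace V] {n : ℕ}
    {F : Y → (Fin n → V) → ZMod p} (hF : Continuous fun z : Y × (Fin n → V) => F z.1 z.2) :
    Continuous fun z : Y × (Fin (n + 1) → V) => cechD n (F z.1) z.2 := by
  simp only [cechD_def]
  refine continuous_finsetSum _ fun j _ => Continuous.zsmul ?_ _
  exact hF.comp (continuous_fst.prodMk ((continuous_removeNth j).comp continuous_snd))

theorem cechX_mem {π : G →ₜ* Q} {n : ℕ} {F : X → (Fin n → G) → ZMod p}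
    (hF : F ∈ homCochains p X π n) : cechX X G n F ∈ homCochains p X π (n + 1) := by
  refine ⟨continuous_cechD hF.1, fun g x h => ?_⟩
  simp only [cechX_apply, cechD_def]
  exact Finset.sum_congr rfl fun j _ => congrArg _ (hF.2 g x (j.removeNth h))

/-- Inflation of cochains with parameters. -/
def inflX (X : Type*) (π : G →ₜ* Q) (n : ℕ) :
    (X → (Fin n → Q) → ZMod p) →+ (X → (Fin n → G) → ZMod p) where
  toFun F x h := F x (π ∘ h)
  map_zero' := rfl
  map_add' _ _ := rfl

theorem inflX_apply (π : G →ₜ* Q) {n : ℕ} (F : X → (Fin n → Q) → ZMod p) (x : X) (h : Fin n → G) :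
    inflX X π n F x h = F x (π ∘ h) := rfl

theorem cechX_inflX (π : G →ₜ* Q) {n : ℕ} (F : X → (Fin n → Q) → ZMod p) :
    cechX X G n (inflX X π n F) = inflX X π (n + 1) (cechX X Q n F) := rfl

theorem comp_smul (π : G →ₜ* Q) {n : ℕ} (g : G) (h : Fin n → G) : π ∘ (g • h) = π g • (π ∘ h) :=
  funext fun _ => map_mul π _ _

theorem inflX_mem {π : G →ₜ* Q} {n : ℕ} {F : X → (Fin n → Q) → ZMod p}
    (hF : F ∈ homCochains p X (ContinuousMonoidHom.id Q) n) :
    inflX X π n F ∈ homCochains p X π n := by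
  refine ⟨hF.1.comp (continuous_fst.prodMk (continuous_pi fun i =>
    π.continuous_toFun.comp ((continuous_apply i).comp continuous_snd))), fun g x h => ?_⟩
  simp only [inflX_apply, comp_smul]
  exact hF.2 (π g) x (π ∘ h)

/-- The cup product of an inflated cochain with a homomorphism `β : G → ℤ/p`, in terms of
homogeneous cochains. -/
def cupX (X : Type*) (π : G →ₜ* Q) (β : G → ZMod p) (n : ℕ) :
    (X → (Fin (n + 1) → Q) → ZMod p) →+ (X → (Fin (n + 2) → G) → ZMod p) where
  toFun F x h := F x (π ∘ Fin.init h) * (β (h (Fin.last _)) - β (h (Fin.last _).castSucc))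
  map_zero' := by
    ext
    simp
  map_add' _ _ := by
    ext
    simp [add_mul]

theorem cupX_apply (π : G →ₜ* Q) (β : G → ZMod p) {n : ℕ} (F : X → (Fin (n + 1) → Q) → ZMod p)
    (x : X) (h : Fin (n + 2) → G) : cupX X π β n F x h =
      F x (π ∘ Fin.init h) * (β (h (Fin.last _)) - β (h (Fin.last _).castSucc)) := rfl

theorem comp_init_cons (π : G → Q) {n : ℕ} (v : G) (h : Fin (n + 1) → G) :
    π ∘ Fin.init (Fin.cons v h : Fin (n + 2) → G) =
      (Fin.cons (π v) (π ∘ Fin.init h) : Fin (n + 1) → Q) := by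
  funext i
  refine Fin.cases ?_ (fun i => ?_) i <;> simp [Fin.init]

/-- The difference of values of `β` is a closed cochain and is the last factor, so Leibniz leaves
one term without a sign. -/
theorem cechX_cupX (π : G →ₜ* Q) (β : G → ZMod p) {n : ℕ} (F : X → (Fin (n + 1) → Q) → ZMod p) :
    cechX X G (n + 2) (cupX X π β n F) = cupX X π β (n + 1) (cechX X Q (n + 1) F) := by
  induction n generalizing X with
  | zero =>
    funext x h
    have h1 : (cupX X π β 0 F x) = fun h' : Fin 2 → G =>
        F x (fun _ => π (h' 0)) * (β (h' 1) - β (h' 0)) := by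
      funext h'
      rw [cupX_apply]
      congr 2
      funext i
      fin_cases i
      rfl
    rw [cechX_apply, cupX_apply, cechX_apply, cechD_one, h1, ← Fin.cons_self_tail h, cechD_cons,
      cechD_one]
    change F x (fun _ => π (h 1)) * (β (h 2) - β (h 1)) -
      (F x (fun _ => π (h 0)) * (β (h 2) - β (h 0)) -
        F x (fun _ => π (h 0)) * (β (h 1) - β (h 0))) =
      (F x (fun _ => π (h 1)) - F x (fun _ => π (h 0))) * (β (h 2) - β (h 1))
    ring
  | succ n ih =>
    funext x h
    have h1 : ∀ (m : ℕ) (F : X → (Fin (m + 2) → Q) → ZMod p) (v : G) (h' : Fin (m + 2) → G),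
        cupX X π β (m + 1) F x (Fin.cons v h' : Fin (m + 3) → G) =
        cupX X π β m (fun x h => F x (Fin.cons (π v) h : Fin (m + 2) → Q)) x h' := by
      intro m F v h'
      rw [cupX_apply, cupX_apply, comp_init_cons]
      rfl
    rw [← Fin.cons_self_tail h, h1, cechX_apply, cechD_cons]
    simp only [h1]
    rw [← cechX_apply (F := cupX X π β n _), ih]
    simp only [cupX_apply, cechX_apply, cechD_cons]
    ring

theorem cupX_mem {π : G →ₜ* Q} {β : G → ZMod p} (hβ : Continuous β)
    (hmul : ∀ x y, β (x * y) = β x + β y) {n : ℕ} {F : X → (Fin (n + 1) → Q) → ZMod p}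
    (hF : F ∈ homCochains p X (ContinuousMonoidHom.id Q) (n + 1)) :
    cupX X π β n F ∈ homCochains p X π (n + 2) := by
  constructor
  · refine Continuous.mul ?_ ?_
    · refine hF.1.comp (continuous_fst.prodMk (continuous_pi fun i =>
        π.continuous_toFun.comp ((continuous_apply i.castSucc).comp continuous_snd)))
    · fun_prop
  · intro g x h
    simp only [cupX_apply]
    have h1 : π ∘ Fin.init (g • h) = π g • (π ∘ Fin.init h) := comp_smul π g (Fin.init h)
    rw [h1]
    refine congrArg₂ (· * ·) (hF.2 (π g) x _) ?_
    simp [hmul]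

end Homogeneous

/-- A continuous surjection `π : G → Q` of topological groups with a continuous section and with
kernel `ℤ_p`; `coord` is the coordinate of an element of `G` along the kernel. -/
structure PadicFibration (p : ℕ) [Fact p.Prime] (G Q : Type*) [Group G] [TopologicalSpace G]
    [Group Q] [TopologicalSpace Q] where
  π : G →ₜ* Q
  σ : C(Q, G)
  ζ : Multiplicative ℤ_[p] →ₜ* G
  coord : C(G, ℤ_[p])
  π_σ : ∀ q, π (σ q) = q
  π_ζ : ∀ z, π (ζ z) = 1
  coord_mul : ∀ x, coord (x * ζ (.ofAdd 1)) = coord x + 1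
  σ_mul_ζ : ∀ x, σ (π x) * ζ (.ofAdd (coord x)) = x

/-! ### Columns with a parameter: the cohomology of the kernel `ℤ_p` -/

section Columns

variable {p : ℕ} [Fact p.Prime] {G Q : Type*} [Group G] [TopologicalSpace G] [IsTopologicalGroup G]
  [Group Q] [TopologicalSpace Q] [IsTopologicalGroup Q]
  {X : Type*} [TopologicalSpace X] [MulAction Q X] [ContinuousSMul Q X]

/-- Over a `Q`-space with an equivariant map to `Q`, homogeneous cochains of `Q` are acyclic. -/
theorem exists_cechX_eq {e : C(X, Q)} (he : ∀ q x, e (q • x) = q * e x) {n : ℕ}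
    {F : X → (Fin (n + 1) → Q) → ZMod p}
    (hF : F ∈ homCochains p X (ContinuousMonoidHom.id Q) (n + 1))
    (hd : cechX X Q (n + 1) F = 0) :
    ∃ F' ∈ homCochains p X (ContinuousMonoidHom.id Q) n, cechX X Q n F' = F := by
  -- The contraction inserts `e x`; equivariance of `e` keeps the result homogeneous.
  refine ⟨fun x h => F x (Fin.cons (e x) h : Fin (n + 1) → Q), ⟨?_, fun g x h => ?_⟩, ?_⟩
  · exact hF.1.comp (continuous_fst.prodMk
      (continuous_cons (e.continuous.comp continuous_fst) continuous_snd))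
  · change F (g • x) (Fin.cons (e (g • x)) (g • h) : Fin (n + 1) → Q) = _
    rw [he, smul_cons]
    exact hF.2 g x _
  · funext x h
    exact (eq_cechD_of_closed (congrFun hd x) (e x) h).symm

namespace PadicFibration

variable (D : PadicFibration p G Q)

/-- The image of `1 ∈ ℤ_p`. -/
def γ : G := D.ζ (.ofAdd 1)

theorem π_mul_γ (x : G) : D.π (x * D.γ) = D.π x := by
  rw [map_mul, γ, D.π_ζ, mul_one]

theorem eq_of_forall_mul_γ {f : G → ZMod p} (hf : Continuous f) (h : ∀ x, f (x * D.γ) = f x)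
    (x : G) : f x = f (D.σ (D.π x)) := by
  have := eq_of_difference_eq_zero
    (f := fun z : ℤ_[p] => f (D.σ (D.π x) * D.ζ (.ofAdd z)))
    (hf.comp (continuous_const.mul (D.ζ.continuous_toFun.comp continuous_ofAdd)))
    (fun z => by
      rw [ofAdd_add, map_mul, ← mul_assoc]
      exact h _) (D.coord x)
  rw [D.σ_mul_ζ] at this
  simpa using this

/-- Fibres of `π` are orbits of `ℤ_p`, in which the powers of `γ` are dense; invariance under `γ`
therefore means descent to `Q`. -/
theorem eq_of_π_eq {f : G → ZMod p} (hf : Continuous f) (h : ∀ x, f (x * D.γ) = f x)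
    {x y : G} (hxy : D.π x = D.π y) : f x = f y := by
  rw [D.eq_of_forall_mul_γ hf h x, D.eq_of_forall_mul_γ hf h y, hxy]

/-- Invariant solutions of difference equations. -/
theorem exists_difference_eq {n : ℕ} {w : G → X → (Fin (n + 1) → G) → ZMod p}
    (hw : Continuous fun z : G × X × (Fin (n + 1) → G) => w z.1 z.2.1 z.2.2)
    (hinv : ∀ g x q h, w (g * x) (D.π g • q) (g • h) = w x q h) :
    ∃ w' : G → X → (Fin (n + 1) → G) → ZMod p,
      (Continuous fun z : G × X × (Fin (n + 1) → G) => w' z.1 z.2.1 z.2.2) ∧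
      (∀ g x q h, w' (g * x) (D.π g • q) (g • h) = w' x q h) ∧
      ∀ x q h, w' (x * D.γ) q h - w' x q h = w x q h := by
  have hσ := D.σ.continuous
  have hζ : Continuous D.ζ := D.ζ.continuous_toFun
  have hπ : Continuous D.π := D.π.continuous_toFun
  have hc := D.coord.continuous
  -- The section trivializes `G` as `Q × ℤ_p`, so the equation is solved along the fibres, with no
  -- regard to invariance yet.
  obtain ⟨W, hW⟩ := exists_difference_eq_of_prod (p := p) (T := Q × X × (Fin (n + 1) → G))
    ⟨fun z => w (D.σ z.2.1 * D.ζ (.ofAdd z.1)) z.2.2.1 z.2.2.2,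
      hw.comp (((hσ.comp continuous_snd.fst).mul
        (hζ.comp (continuous_ofAdd.comp continuous_fst))).prodMk continuous_snd.snd)⟩
  let S : G → X → (Fin (n + 1) → G) → ZMod p := fun x q h => W (D.coord x, D.π x, q, h)
  have hS : ∀ x q h, S (x * D.γ) q h - S x q h = w x q h := fun x q h => by
    change W (D.coord (x * D.γ), D.π (x * D.γ), q, h) - W (D.coord x, D.π x, q, h) = w x q h
    rw [D.π_mul_γ, γ, D.coord_mul, hW]
    change w (D.σ (D.π x) * D.ζ (.ofAdd (D.coord x))) q h = _
    rw [D.σ_mul_ζ]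
  -- Translating everything by `(h 0)⁻¹` enforces invariance. The equation survives because left
  -- translation commutes with right multiplication by `γ` and `w` is invariant.
  refine ⟨fun x q h => S ((h 0)⁻¹ * x) (D.π (h 0)⁻¹ • q) ((h 0)⁻¹ • h), ?_, ?_, ?_⟩
  · refine W.continuous.comp ?_
    have h0 : Continuous fun z : G × X × (Fin (n + 1) → G) => (z.2.2 0)⁻¹ :=
      ((continuous_apply 0).comp continuous_snd.snd).inv
    exact (hc.comp (h0.mul continuous_fst)).prodMk ((hπ.comp (h0.mul continuous_fst)).prodMk
      (((hπ.comp h0).smul continuous_snd.fst).prodMk (h0.smul continuous_snd.snd)))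
  · intro g x q h
    have h1 : ((g • h) 0)⁻¹ = (h 0)⁻¹ * g⁻¹ := by simp
    simp only [h1, smul_smul, ← map_mul, mul_assoc, inv_mul_cancel_left, inv_mul_cancel, mul_one]
  · intro x q h
    beta_reduce
    rw [← mul_assoc, hS, ← hinv (h 0)⁻¹ x q h]

/-- Descent of functions that are invariant under the kernel. -/
theorem descend_mem {e : C(X, Q)} (he : ∀ q x, e (q • x) = q * e x) {n : ℕ}
    {v : G → X → (Fin n → G) → ZMod p}
    (hv : Continuous fun z : G × X × (Fin n → G) => v z.1 z.2.1 z.2.2)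
    (hinv : ∀ g x q h, v (g * x) (D.π g • q) (g • h) = v x q h)
    (hγ : ∀ x q h, v (x * D.γ) q h = v x q h) :
    (fun q h => v (D.σ (e q)) q h) ∈ homCochains p X D.π n := by
  constructor
  · exact hv.comp (((D.σ.continuous.comp e.continuous).comp continuous_fst).prodMk continuous_id)
  · intro g q h
    beta_reduce
    rw [← hinv g (D.σ (e q)) q h]
    refine D.eq_of_π_eq (f := fun x => v x (D.π g • q) (g • h))
      (hv.comp (continuous_id.prodMk (continuous_const (y := (D.π g • q, g • h))))) (fun x => hγ _ _ _) ?_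
    rw [D.π_σ, he, map_mul, D.π_σ]

/-- The cohomology of `ℤ_p` vanishes in degrees `≥ 2`. -/
theorem exists_cechX_eq_of_two_le {e : C(X, Q)} (he : ∀ q x, e (q • x) = q * e x) {n : ℕ}
    {F : X → (Fin (n + 3) → G) → ZMod p} (hF : F ∈ homCochains p X D.π (n + 3))
    (hd : cechX X G (n + 3) F = 0) :
    ∃ F' ∈ homCochains p X D.π (n + 2), cechX X G (n + 2) F' = F := by
  -- The primitive obtained by inserting `x ∈ G` depends on `x`. It must be corrected until it is
  -- constant on the fibres of `π`, so that `x` can be taken over `e q`.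
  let u : G → X → (Fin (n + 2) → G) → ZMod p := fun x q h => F q (Fin.cons x h : Fin (n + 3) → G)
  have hu : ∀ x q, cechD (n + 2) (u x q) = F q := fun x q => funext fun h =>
    (eq_cechD_of_closed (congrFun hd q) x h).symm
  have huc : Continuous fun z : G × X × (Fin (n + 2) → G) => u z.1 z.2.1 z.2.2 :=
    hF.1.comp (continuous_snd.fst.prodMk (continuous_cons continuous_fst continuous_snd.snd))
  have hui : ∀ g x q h, u (g * x) (D.π g • q) (g • h) = u x q h := fun g x q h => by
    change F (D.π g • q) (Fin.cons (g * x) (g • h) : Fin (n + 3) → G) = _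
    rw [smul_cons]
    exact hF.2 g q _
  let Δ : G → X → (Fin (n + 2) → G) → ZMod p := fun x q => u (x * D.γ) q - u x q
  have hΔ : ∀ x q, cechD (n + 2) (Δ x q) = 0 := fun x q => by
    rw [map_sub, hu, hu, sub_self]
  -- The change `Δ` of the primitive under `x ↦ x γ` is closed, hence is the differential of `w`.
  -- Solving the difference equation for `w` makes `u - d w'` invariant under `γ`, without changing
  -- its differential.
  let w : G → X → (Fin (n + 1) → G) → ZMod p := fun x q h => Δ x q (Fin.cons x h : Fin (n + 2) → G)
  have hw : ∀ x q, cechD (n + 1) (w x q) = Δ x q := fun x q => funext fun h =>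
    (eq_cechD_of_closed (hΔ x q) x h).symm
  have hΔc : Continuous fun z : G × X × (Fin (n + 2) → G) => Δ z.1 z.2.1 z.2.2 :=
    (huc.comp ((continuous_fst.mul continuous_const).prodMk continuous_snd)).sub huc
  have hΔi : ∀ g x q h, Δ (g * x) (D.π g • q) (g • h) = Δ x q h := fun g x q h => by
    change u _ _ _ - u _ _ _ = u _ _ _ - u _ _ _
    rw [mul_assoc, hui, hui]
  obtain ⟨w', hw'c, hw'i, hw'⟩ := D.exists_difference_eq (w := w)
    (hΔc.comp (continuous_fst.prodMk (continuous_snd.fst.prodMk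
      (continuous_cons continuous_fst continuous_snd.snd))))
    (fun g x q h => by
      change Δ (g * x) (D.π g • q) (Fin.cons (g * x) (g • h) : Fin (n + 2) → G) = _
      rw [smul_cons]
      exact hΔi g x q _)
  have hcw' : Continuous fun z : G × X × (Fin (n + 2) → G) =>
      cechD (n + 1) (w' z.1 z.2.1) z.2.2 := by
    have := continuous_cechD (Y := G × X) (F := fun y => w' y.1 y.2)
      (hw'c.comp (continuous_fst.fst.prodMk (continuous_fst.snd.prodMk continuous_snd)))
    exact this.comp ((continuous_fst.prodMk continuous_snd.fst).prodMk continuous_snd.snd)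
  refine ⟨_, D.descend_mem he (v := fun x q => u x q - cechD (n + 1) (w' x q))
    (huc.sub hcw') (fun g x q h => ?_) (fun x q h => ?_), ?_⟩
  · refine congrArg₂ (· - ·) (hui g x q h) ?_
    simp only [cechD_def]
    exact Finset.sum_congr rfl fun j _ => congrArg _ (hw'i g x q (j.removeNth h))
  · have h1 : w' (x * D.γ) q = w x q + w' x q := funext fun h' => by
      rw [Pi.add_apply, ← hw', sub_add_cancel]
    change u (x * D.γ) q h - cechD (n + 1) (w' (x * D.γ) q) h = _
    rw [h1, map_add, hw]
    change u (x * D.γ) q h - (u (x * D.γ) q h - u x q h + _) = u x q h - _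
    ring
  · funext q
    rw [cechX_apply]
    change cechD (n + 2) (u (D.σ (e q)) q - cechD (n + 1) (w' (D.σ (e q)) q)) = F q
    rw [map_sub, hu, cechD_cechD, sub_zero]

variable {β : G → ZMod p} (hβ : Continuous β) (hmul : ∀ x y, β (x * y) = β x + β y)
  (hβγ : β D.γ = 1)

include hβ hmul hβγ in
/-- The first cohomology of `ℤ_p` is generated by `β`. -/
theorem exists_cechX_add_cupX_eq {e : C(X, Q)} (he : ∀ q x, e (q • x) = q * e x)
    {F : X → (Fin 2 → G) → ZMod p} (hF : F ∈ homCochains p X D.π 2) (hd : cechX X G 2 F = 0) :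
    ∃ F' ∈ homCochains p X D.π 1, ∃ k ∈ homCochains p X (ContinuousMonoidHom.id Q) 1,
      cechX X Q 1 k = 0 ∧ cechX X G 1 F' + cupX X D.π β 0 k = F := by
  let u : G → X → (Fin 1 → G) → ZMod p := fun x q h => F q (Fin.cons x h : Fin 2 → G)
  have hu : ∀ x q, cechD 1 (u x q) = F q := fun x q => funext fun h =>
    (eq_cechD_of_closed (congrFun hd q) x h).symm
  have huc : Continuous fun z : G × X × (Fin 1 → G) => u z.1 z.2.1 z.2.2 :=
    hF.1.comp (continuous_snd.fst.prodMk (continuous_cons continuous_fst continuous_snd.snd))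
  have hui : ∀ g x q h, u (g * x) (D.π g • q) (g • h) = u x q h := fun g x q h => by
    change F (D.π g • q) (Fin.cons (g * x) (g • h) : Fin 2 → G) = _
    rw [smul_cons]
    exact hF.2 g q _
  -- In this degree the change of the primitive is a closed function of one argument, hence a
  -- constant `κ`, which is the obstruction to descent.
  let κ : G → X → ZMod p := fun x q => u (x * D.γ) q (fun _ => x) - u x q (fun _ => x)
  have hκ : ∀ x q h, u (x * D.γ) q h - u x q h = κ x q := fun x q h => by
    have h1 : cechD 1 (u (x * D.γ) q - u x q) = 0 := by rw [map_sub, hu, hu, sub_self]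
    have h2 := eq_cechD_of_closed h1 x h
    rw [cechD_zero] at h2
    refine h2.trans ?_
    have h3 : (Fin.cons x Fin.elim0 : Fin 1 → G) = fun _ => x := by
      funext i
      fin_cases i
      rfl
    exact congrArg (fun h => u (x * D.γ) q h - u x q h) h3
  have hκc : Continuous fun z : G × X => κ z.1 z.2 := by
    have h1 : Continuous fun z : G × X => (fun _ : Fin 1 => z.1) :=
      continuous_pi fun _ => continuous_fst
    exact (huc.comp ((continuous_fst.mul continuous_const).prodMk (continuous_snd.prodMk h1))).sub
      (huc.comp (continuous_fst.prodMk (continuous_snd.prodMk h1)))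
  have hκi : ∀ g x q, κ (g * x) (D.π g • q) = κ x q := fun g x q => by
    change u _ _ (g • fun _ => x) - u _ _ (g • fun _ => x) = _
    rw [mul_assoc, hui, hui]
  have hκπ : ∀ x y q, D.π x = D.π y → κ x q = κ y q := fun x y q hxy => by
    have h1 := hκi (y * x⁻¹) x q
    rwa [inv_mul_cancel_right, map_mul, map_inv, hxy, mul_inv_cancel, one_smul, eq_comm] at h1
  have hmul' : ∀ g x y, β (g * x) - β (g * y) = β x - β y := fun g x y => by
    rw [hmul, hmul]
    ring
  -- Since `β (x γ) = β x + 1`, subtracting `κ β x` cancels the change `κ`, and adding `κ β (h 0)`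
  -- restores homogeneity. The latter term contributes `κ ∪ β` to the differential, hence the class
  -- `-κ`.
  refine ⟨_, D.descend_mem he (v := fun x q h => u x q h + κ x q * (β (h 0) - β x))
    (huc.add ((hκc.comp (continuous_fst.prodMk continuous_snd.fst)).mul
      ((hβ.comp ((continuous_apply 0).comp continuous_snd.snd)).sub (hβ.comp continuous_fst))))
    (fun g x q h => ?_) (fun x q h => ?_),
    fun q _ => -κ (D.σ (e q)) q, ⟨?_, fun g q h => ?_⟩, ?_, ?_⟩
  · rw [hui, hκi]
    change _ + _ * (β (g * h 0) - _) = _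
    rw [hmul']
  · rw [hκπ (x * D.γ) x q (D.π_mul_γ x), hmul, hβγ, ← hκ x q h]
    ring
  · exact (hκc.comp ((D.σ.continuous.comp e.continuous).prodMk continuous_id)).neg.comp
      continuous_fst
  · change -κ (D.σ (e (g • q))) (g • q) = -κ (D.σ (e q)) q
    rw [he, ← hκi (D.σ g) (D.σ (e q)) q, D.π_σ]
    congr 1
    exact hκπ _ _ _ (by rw [D.π_σ, map_mul, D.π_σ, D.π_σ])
  · funext q h
    rw [cechX_apply, cechD_one, sub_self]
    rfl
  · funext q h
    rw [Pi.add_apply, Pi.add_apply, cechX_apply, cechD_one, cupX_apply, ← hu (D.σ (e q)) q,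
      cechD_one]
    change u (D.σ (e q)) q _ + κ _ _ * (β (h 1) - _) -
      (u (D.σ (e q)) q _ + κ _ _ * (β (h 0) - _)) + -κ _ _ * (β (h 1) - β (h 0)) = _
    ring

-- Evaluation at `(1, γ)` detects `k`: the element `γ` acts trivially on `X`, so homogeneity gives
-- `F` equal values at `γ` and `1`, whereas `β` differs by `1`.
include hmul hβγ in
theorem eq_zero_of_cechX_eq_cupX {F : X → (Fin 1 → G) → ZMod p} (hF : F ∈ homCochains p X D.π 1)
    {k : X → (Fin 1 → Q) → ZMod p} (hk : cechX X Q 1 k = 0)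
    (hFk : cechX X G 1 F = cupX X D.π β 0 k) : k = 0 := by
  funext q h
  have hk' : ∀ h h', k q h = k q h' := fun h h' => by
    have h1 := congrFun (congrFun hk q) ![h' 0, h 0]
    rw [cechX_apply, cechD_one] at h1
    refine (sub_eq_zero.1 h1 |> fun h2 => ?_)
    convert h2 using 2 <;> · funext i; fin_cases i; rfl
  have h1 := congrFun (congrFun hFk q) ![1, D.γ]
  have h2 := hF.2 D.γ q (fun _ => 1)
  have h3 : D.π D.γ = 1 := D.π_ζ _
  have h4 : (D.γ • fun _ : Fin 1 => (1 : G)) = fun _ => D.γ := by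
    funext i
    simp
  rw [h3, one_smul, h4] at h2
  have h0 : β 1 = 0 := by simpa using hmul 1 1
  rw [cechX_apply, cechD_one, cupX_apply] at h1
  change F q (fun _ => D.γ) - F q (fun _ => 1) = _ * (β D.γ - β 1) at h1
  rw [h2, sub_self, hβγ, h0, sub_zero, mul_one] at h1
  rw [hk' h, ← h1]
  rfl

/-- A closed cochain of one argument is constant in it, and invariance under lifts `σ g` is then
invariance under `Q`. This is degree zero of the cohomology of the kernel. -/
theorem exists_inflX_eq {F : X → (Fin 1 → G) → ZMod p} (hF : F ∈ homCochains p X D.π 1)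
    (hd : cechX X G 1 F = 0) : ∃ k ∈ homCochains p X (ContinuousMonoidHom.id Q) 1,
      cechX X Q 1 k = 0 ∧ inflX X D.π 1 k = F := by
  have hF' : ∀ q h h', F q h = F q h' := fun q h h' => by
    have h1 := congrFun (congrFun hd q) ![h' 0, h 0]
    rw [cechX_apply, cechD_one] at h1
    refine (sub_eq_zero.1 h1 |> fun h2 => ?_)
    convert h2 using 2 <;> · funext i; fin_cases i; rfl
  refine ⟨fun q _ => F q (fun _ => 1), ⟨?_, fun g q h => ?_⟩, ?_, ?_⟩
  · exact hF.1.comp (continuous_fst.prodMk continuous_const)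
  · beta_reduce
    rw [← hF.2 (D.σ g) q fun _ => 1, D.π_σ]
    exact hF' _ _ _
  · funext q h
    rw [cechX_apply, cechD_one, sub_self]
    rfl
  · funext q h
    exact hF' _ _ _

end PadicFibration

end Columns

/-! ### The cone of inflation and cup product -/

section Cone

variable {p : ℕ} {G Q : Type*} [Group G] [TopologicalSpace G] [IsTopologicalGroup G]
  [Group Q] [TopologicalSpace Q] [IsTopologicalGroup Q]

theorem cechD_cechX {V : Type*} {a n : ℕ} (F : (Fin a → Q) → (Fin n → V) → ZMod p) :
    cechD a (cechX _ V n F) = cechX _ V n (cechD a F) := by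
  funext q
  rw [cechX_apply, cechD_def, cechD_def, map_sum]
  simp only [map_zsmul, cechX_apply]

theorem cechD_inflX (π : G →ₜ* Q) {a n : ℕ} (F : (Fin a → Q) → (Fin n → Q) → ZMod p) :
    cechD a (inflX _ π n F) = inflX _ π n (cechD a F) := by
  funext q h
  simp only [inflX_apply, cechD_apply]

theorem cechD_cupX (π : G →ₜ* Q) (β : G → ZMod p) {a n : ℕ}
    (F : (Fin a → Q) → (Fin (n + 1) → Q) → ZMod p) :
    cechD a (cupX _ π β n F) = cupX _ π β n (cechD a F) := by
  funext q h
  simp only [cupX_apply, cechD_apply]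
  simp only [cechD_def, Finset.sum_mul, smul_mul_assoc]

theorem cechD_mem {π : G →ₜ* Q} {a n : ℕ} {F : (Fin a → Q) → (Fin n → G) → ZMod p}
    (hF : F ∈ homCochains p (Fin a → Q) π n) :
    cechD a F ∈ homCochains p (Fin (a + 1) → Q) π n := by
  constructor
  · simp only [cechD_apply]
    simp only [cechD_def]
    refine continuous_finsetSum _ fun j _ => Continuous.zsmul ?_ _
    exact hF.1.comp (((continuous_removeNth j).comp continuous_fst).prodMk continuous_snd)
  · intro g q h
    simp only [cechD_apply]
    simp only [cechD_def]
    exact Finset.sum_congr rfl fun j _ => congrArg _ (hF.2 g (j.removeNth q) h)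

/-- The new parameter is set equal to `π (h 0)`, which is equivariant; this is why at least one
group argument is required. -/
theorem exists_cechD_eq {π : G →ₜ* Q} {a n : ℕ} {F : (Fin (a + 1) → Q) → (Fin (n + 1) → G) → ZMod p}
    (hF : F ∈ homCochains p (Fin (a + 1) → Q) π (n + 1)) (hd : cechD (a + 1) F = 0) :
    ∃ F' ∈ homCochains p (Fin a → Q) π (n + 1), cechD a F' = F := by
  refine ⟨fun q h => F (Fin.cons (π (h 0)) q : Fin (a + 1) → Q) h, ⟨?_, fun g q h => ?_⟩, ?_⟩
  · exact hF.1.comp ((continuous_cons (π.continuous_toFun.comp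
      ((continuous_apply 0).comp continuous_snd)) continuous_fst).prodMk continuous_snd)
  · change F (Fin.cons (π (g * h 0)) (π g • q) : Fin (a + 1) → Q) (g • h) = _
    rw [map_mul, smul_cons]
    exact hF.2 g _ h
  · funext q h
    have h1 : cechD (a + 1) (fun q' => F q' h) = 0 := by
      funext q'
      rw [← cechD_apply, hd]
      rfl
    rw [cechD_apply, eq_cechD_of_closed h1 (π (h 0)) q]

theorem eq_zero_of_cechD_eq_zero {M : Type*} [AddCommGroup M] {F : (Fin 0 → Q) → M}
    (hd : cechD 0 F = 0) : F = 0 := by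
  funext q
  have := congrFun hd fun _ => 1
  rw [cechD_zero] at this
  rw [Subsingleton.elim q Fin.elim0, this]
  rfl

theorem inflX_injective {X : Type*} {π : G →ₜ* Q} (hπ : Function.Surjective π) {n : ℕ}
    {F : X → (Fin n → Q) → ZMod p} (h : inflX X π n F = 0) : F = 0 := by
  funext x q
  choose s hs using hπ
  have := congrFun (congrFun h x) (s ∘ q)
  change F x (π ∘ s ∘ q) = 0 at this
  rw [← Function.comp_assoc, show π ∘ s = id from funext hs] at this
  exact this

/-- The cone of `(f, g) ↦ inf f + inf g ∪ β`. -/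
abbrev Cone (p : ℕ) (G Q X : Type*) (b : ℕ) : Type _ :=
  (X → (Fin (b + 1) → G) → ZMod p) × (X → (Fin (b + 2) → Q) → ZMod p) ×
    (X → (Fin (b + 1) → Q) → ZMod p)

/-- The differential of the cone. -/
def coneD (X : Type*) (π : G →ₜ* Q) (β : G → ZMod p) (b : ℕ) :
    Cone p G Q X b →+ Cone p G Q X (b + 1) where
  toFun z := (inflX X π (b + 2) z.2.1 + cupX X π β b z.2.2 - cechX X G (b + 1) z.1,
    cechX X Q (b + 2) z.2.1, cechX X Q (b + 1) z.2.2)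
  map_zero' := by simp
  map_add' z z' := by
    refine Prod.ext ?_ (Prod.ext (map_add _ _ _) (map_add _ _ _))
    simp only [Prod.fst_add, Prod.snd_add, map_add]
    abel

/-- The augmentation of the cone. -/
def coneε (X : Type*) (π : G →ₜ* Q) : (X → (Fin 1 → Q) → ZMod p) →+ Cone p G Q X 0 where
  toFun z := (inflX X π 1 z, cechX X Q 1 z, 0)
  map_zero' := by simp
  map_add' z z' := by simp

theorem coneD_apply (X : Type*) (π : G →ₜ* Q) (β : G → ZMod p) (b : ℕ) (z : Cone p G Q X b) :
    coneD X π β b z = (inflX X π (b + 2) z.2.1 + cupX X π β b z.2.2 - cechX X G (b + 1) z.1,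
      cechX X Q (b + 2) z.2.1, cechX X Q (b + 1) z.2.2) := rfl

theorem coneε_apply (X : Type*) (π : G →ₜ* Q) (z : X → (Fin 1 → Q) → ZMod p) :
    coneε X π z = (inflX X π 1 z, cechX X Q 1 z, 0) := rfl

/-- The elements of the cone with continuous homogeneous components. -/
def coneHom (X : Type*) [TopologicalSpace X] [MulAction Q X] (π : G →ₜ* Q) (b : ℕ) :
    AddSubgroup (Cone p G Q X b) :=
  (homCochains p X π (b + 1)).prod ((homCochains p X (ContinuousMonoidHom.id Q) (b + 2)).prod
    (homCochains p X (ContinuousMonoidHom.id Q) (b + 1)))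

theorem mem_coneHom {X : Type*} [TopologicalSpace X] [MulAction Q X] {π : G →ₜ* Q} {b : ℕ}
    {z : Cone p G Q X b} : z ∈ coneHom X π b ↔ z.1 ∈ homCochains p X π (b + 1) ∧
      z.2.1 ∈ homCochains p X (ContinuousMonoidHom.id Q) (b + 2) ∧
      z.2.2 ∈ homCochains p X (ContinuousMonoidHom.id Q) (b + 1) := Iff.rfl

/-- The Čech differential of the cone in the direction of the parameters. -/
def coneH (p : ℕ) (G Q : Type*) (a b : ℕ) :
    Cone p G Q (Fin a → Q) b →+ Cone p G Q (Fin (a + 1) → Q) b where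
  toFun z := (cechD a z.1, cechD a z.2.1, cechD a z.2.2)
  map_zero' := by simp
  map_add' z z' := by simp

theorem coneH_apply {a b : ℕ} (z : Cone p G Q (Fin a → Q) b) :
    coneH p G Q a b z = (cechD a z.1, cechD a z.2.1, cechD a z.2.2) := rfl

variable [Fact p.Prime] (D : PadicFibration p G Q) {β : G → ZMod p} (hβ : Continuous β)
  (hmul : ∀ x y, β (x * y) = β x + β y) (hβγ : β D.γ = 1)

theorem PadicFibration.π_surjective : Function.Surjective D.π := fun q => ⟨D.σ q, D.π_σ q⟩

include hβ hmul hβγ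

/-- After removing a primitive of `f`, the remaining `0`-cochain has differential `g ∪ β`.
Independence of `β` forces `g = 0`, and a closed `0`-cochain is inflated. -/
theorem exists_coneε_eq {X : Type*} [TopologicalSpace X] [MulAction Q X]
    [ContinuousSMul Q X] {e : C(X, Q)} (he : ∀ q x, e (q • x) = q * e x)
    {z : Cone p G Q X 0} (hz : z ∈ coneHom X D.π 0) (hd : coneD X D.π β 0 z = 0) :
    ∃ y ∈ homCochains p X (ContinuousMonoidHom.id Q) 1, coneε X D.π y = z := by
  obtain ⟨h, f, g⟩ := z
  obtain ⟨hh, hf, hg⟩ := mem_coneHom.1 hz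
  dsimp only at hh hf hg
  simp only [coneD_apply, Prod.mk_eq_zero] at hd
  obtain ⟨hd1, hd2, hd3⟩ := hd
  obtain ⟨f0, hf0, rfl⟩ := exists_cechX_eq he hf hd2
  have h1 : cechX X G 1 (h - inflX X D.π 1 f0) = cupX X D.π β 0 g := by
    rw [map_sub, cechX_inflX, ← sub_eq_zero, ← neg_eq_zero, ← hd1]
    abel
  have h2 := sub_mem hh (inflX_mem (π := D.π) hf0)
  obtain rfl := D.eq_zero_of_cechX_eq_cupX hmul hβγ h2 hd3 h1
  rw [map_zero] at h1
  obtain ⟨f1, hf1, hdf1, hf1'⟩ := D.exists_inflX_eq h2 h1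
  refine ⟨f0 + f1, add_mem hf0 hf1, ?_⟩
  rw [coneε_apply, map_add, map_add, hdf1, hf1', add_zero, add_sub_cancel]

/-- Both `Q`-components have primitives by acyclicity. What remains of `h` is closed, so it is exact
in degree at least two and exact up to a multiple of `β` in degree one. -/
theorem exists_coneD_eq {X : Type*} [TopologicalSpace X] [MulAction Q X]
    [ContinuousSMul Q X] {e : C(X, Q)} (he : ∀ q x, e (q • x) = q * e x) {b : ℕ}
    {z : Cone p G Q X (b + 1)} (hz : z ∈ coneHom X D.π (b + 1))
    (hd : coneD X D.π β (b + 1) z = 0) :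
    ∃ y ∈ coneHom X D.π b, coneD X D.π β b y = z := by
  obtain ⟨h, f, g⟩ := z
  obtain ⟨hh, hf, hg⟩ := mem_coneHom.1 hz
  dsimp only at hh hf hg
  simp only [coneD_apply, Prod.mk_eq_zero] at hd
  obtain ⟨hd1, hd2, hd3⟩ := hd
  obtain ⟨f0, hf0, rfl⟩ := exists_cechX_eq he hf hd2
  obtain ⟨g0, hg0, rfl⟩ := exists_cechX_eq he hg hd3
  have h1 : cechX X G (b + 2) (h - inflX X D.π (b + 2) f0 - cupX X D.π β b g0) = 0 := by
    rw [map_sub, map_sub, cechX_inflX, cechX_cupX, ← neg_eq_zero, ← hd1]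
    abel
  have h2 := sub_mem (sub_mem hh (inflX_mem (π := D.π) hf0)) (cupX_mem (π := D.π) hβ hmul hg0)
  cases b with
  | zero =>
    obtain ⟨v, hv, k, hk, hdk, hvk⟩ := D.exists_cechX_add_cupX_eq hβ hmul hβγ he h2 h1
    -- The multiple of `β` is absorbed into the last component, which is harmless because `k` is
    -- closed; the sign of `v` comes from the cone differential.
    refine ⟨(-v, f0, g0 + k), mem_coneHom.2 ⟨neg_mem hv, hf0, add_mem hg0 hk⟩, ?_⟩
    simp only [coneD_apply, map_add, map_neg, hdk, add_zero]
    refine Prod.ext ?_ rfl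
    rw [eq_sub_iff_add_eq, eq_sub_iff_add_eq] at hvk
    change inflX X D.π 2 f0 + (cupX X D.π β 0 g0 + cupX X D.π β 0 k) - -cechX X G 1 v = h
    rw [← hvk]
    abel
  | succ b =>
    obtain ⟨v, hv, hdv⟩ := D.exists_cechX_eq_of_two_le he h2 h1
    refine ⟨(-v, f0, g0), mem_coneHom.2 ⟨neg_mem hv, hf0, hg0⟩, ?_⟩
    simp only [coneD_apply, map_neg, hdv]
    refine Prod.ext ?_ rfl
    change inflX X D.π (b + 3) f0 + cupX X D.π β (b + 1) g0 -
      -(h - inflX X D.π (b + 3) f0 - cupX X D.π β (b + 1) g0) = h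
    abel

theorem cone_exact :
    (∀ x ∈ coneHom (Fin 0 → Q) D.π 0, coneD (Fin 0 → Q) D.π β 0 x = 0 →
      ∃ y ∈ homCochains p (Fin 0 → Q) (ContinuousMonoidHom.id Q) 1, coneε _ D.π y = x) ∧
    ∀ b, ∀ x ∈ coneHom (Fin 0 → Q) D.π (b + 1), coneD (Fin 0 → Q) D.π β (b + 1) x = 0 →
      ∃ y ∈ coneHom (Fin 0 → Q) D.π b, coneD _ D.π β b y = x := by
  -- The first coordinate of `Q^(a + 1)` is the equivariant map to `Q` that makes every column but
  -- the zeroth accessible.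
  have he : ∀ (a : ℕ) (q : Q) (x : Fin (a + 1) → Q),
      (⟨fun x => x 0, continuous_apply 0⟩ : C(Fin (a + 1) → Q, Q)) (q • x) =
        q * (⟨fun x => x 0, continuous_apply 0⟩ : C(Fin (a + 1) → Q, Q)) x := fun _ _ _ => rfl
  refine exact_of_exact_rows (K := fun a b => Cone p G Q (Fin a → Q) b)
    (E := fun a => (Fin a → Q) → (Fin 1 → Q) → ZMod p)
    (dh := coneH p G Q) (dv := fun a b => coneD _ D.π β b)
    (dE := fun a => cechD a) (ε := fun a => coneε _ D.π) (I := fun a b => coneHom _ D.π b)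
    (J := fun a => homCochains p _ (ContinuousMonoidHom.id Q) 1)
    ?_ ?_ ?_ ?_ ?_ ?_ ?_ ?_ ?_ ?_ ?_ ?_ ?_ ?_ ?_
  · intro a b x hx
    rw [mem_coneHom] at hx ⊢
    exact ⟨cechD_mem hx.1, cechD_mem hx.2.1, cechD_mem hx.2.2⟩
  · intro a b x hx
    rw [mem_coneHom] at hx ⊢
    exact ⟨sub_mem (add_mem (inflX_mem hx.2.1) (cupX_mem hβ hmul hx.2.2)) (cechX_mem hx.1),
      cechX_mem hx.2.1, cechX_mem hx.2.2⟩
  · exact fun a x hx => cechD_mem hx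
  · exact fun a x hx => mem_coneHom.2 ⟨inflX_mem hx, cechX_mem hx, zero_mem _⟩
  · intro a b x
    simp only [coneH_apply, coneD_apply, map_sub, map_add, cechD_cechX, cechD_inflX, cechD_cupX]
  · intro a x
    simp only [coneH_apply, coneε_apply, cechD_cechX, cechD_inflX, map_zero]
  · intro a b x
    simp only [coneD_apply, map_sub, map_add, cechX_cechX, cechX_inflX, cechX_cupX]
    simp
  · intro a x
    simp only [coneD_apply, coneε_apply, cechX_cechX, cechX_inflX, map_zero]
    simp
  · intro a b x
    simp only [coneH_apply, cechD_cechD]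
    rfl
  · intro b x _ hx
    simp only [coneH_apply, Prod.mk_eq_zero] at hx
    exact Prod.ext (eq_zero_of_cechD_eq_zero hx.1) (Prod.ext (eq_zero_of_cechD_eq_zero hx.2.1)
      (eq_zero_of_cechD_eq_zero hx.2.2))
  · intro a b x hx hd
    simp only [coneH_apply, Prod.mk_eq_zero] at hd
    rw [mem_coneHom] at hx
    obtain ⟨y1, hy1, h1⟩ := exists_cechD_eq hx.1 hd.1
    obtain ⟨y2, hy2, h2⟩ := exists_cechD_eq hx.2.1 hd.2.1
    obtain ⟨y3, hy3, h3⟩ := exists_cechD_eq hx.2.2 hd.2.2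
    exact ⟨(y1, y2, y3), mem_coneHom.2 ⟨hy1, hy2, hy3⟩, Prod.ext h1 (Prod.ext h2 h3)⟩
  · exact fun a x hx hd => exists_cechD_eq hx hd
  · exact fun a x _ hd => inflX_injective D.π_surjective (congrArg Prod.fst hd)
  · exact fun a x hx hd => exists_coneε_eq D hβ hmul hβγ (he a) hx hd
  · exact fun a b x hx hd => exists_coneD_eq D hβ hmul hβγ (he a) hx hd

end Cone

/-! ## The Gysin decomposition -/

section Gysin

variable {p : ℕ} {G Q : Type*} [Group G] [TopologicalSpace G] [IsTopologicalGroup G]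
  [Group Q] [TopologicalSpace Q] [IsTopologicalGroup Q]

/-- The homogeneous cochain attached to an inhomogeneous one. -/
def homog (Q : Type*) {p : ℕ} {G : Type*} [Group G] [TopologicalSpace G] (n : ℕ) :
    Cochain p G n →+ ((Fin 0 → Q) → (Fin (n + 1) → G) → ZMod p) where
  toFun f _ h := f fun i => (h i.castSucc)⁻¹ * h i.succ
  map_zero' := rfl
  map_add' _ _ := rfl

theorem homog_apply {n : ℕ} (f : Cochain p G n) (q : Fin 0 → Q) (h : Fin (n + 1) → G) :
    homog Q n f q h = f fun i => (h i.castSucc)⁻¹ * h i.succ := rfl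

theorem homog_mem (π : G →ₜ* Q) {n : ℕ} (f : Cochain p G n) :
    homog Q n f ∈ homCochains p (Fin 0 → Q) π (n + 1) := by
  constructor
  · simp only [homog_apply]
    fun_prop
  · intro g q h
    simp only [homog_apply]
    congr 1
    funext i
    simp [mul_assoc]

theorem homog_injective {n : ℕ} : Function.Injective (homog (p := p) (G := G) Q n) := by
  intro f f' h
  ext x
  have := congrFun (congrFun h Fin.elim0) (Fin.partialProd x)
  simpa only [homog_apply, Fin.partialProd_right_inv] using this

theorem continuous_partialProd (n : ℕ) : Continuous fun x : Fin n → G => Fin.partialProd x := by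
  refine continuous_pi fun i => ?_
  induction i using Fin.induction with
  | zero => simpa using continuous_const
  | succ i ih =>
    simp only [Fin.partialProd_succ]
    exact ih.mul (continuous_apply i)

/-- Homogeneity translates the first argument to `1`; the remaining ones are then the partial
products of the successive quotients. -/
theorem exists_homog_eq {π : G →ₜ* Q} {n : ℕ} {F : (Fin 0 → Q) → (Fin (n + 1) → G) → ZMod p}
    (hF : F ∈ homCochains p (Fin 0 → Q) π (n + 1)) : ∃ f : Cochain p G n, homog Q n f = F := by
  refine ⟨⟨fun x => F Fin.elim0 (Fin.partialProd x),
    hF.1.comp (continuous_const.prodMk (continuous_partialProd n))⟩, ?_⟩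
  funext q h
  change F Fin.elim0 (Fin.partialProd fun i => (h i.castSucc)⁻¹ * h i.succ) = F q h
  rw [← hF.2 (h 0), Subsingleton.elim (_ • _) q]
  congr 1
  funext i
  rw [Pi.smul_apply, smul_eq_mul]
  induction i using Fin.induction with
  | zero => simp
  | succ i ih => rw [Fin.partialProd_succ, ← mul_assoc, ih, mul_inv_cancel_left]

/-- Dropping an inner vertex multiplies the two adjacent edges, and dropping the last vertex drops
the last edge. This matches the homogeneous and inhomogeneous differentials. -/
theorem diff_removeNth_succ {n : ℕ} (h : Fin (n + 2) → G) (j : Fin (n + 1)) :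
    (fun i : Fin n => ((j.succ.removeNth h : Fin (n + 1) → G) i.castSucc)⁻¹ *
      (j.succ.removeNth h : Fin (n + 1) → G) i.succ) =
    Fin.contractNth j (· * ·) fun i : Fin (n + 1) => (h i.castSucc)⁻¹ * h i.succ := by
  funext k
  simp only [Fin.removeNth, Fin.contractNth, Fin.succAbove, Fin.lt_def, Fin.val_castSucc,
    Fin.val_succ]
  rcases lt_trichotomy (k : ℕ) j with hk | hk | hk
  · rw [if_pos (by omega), if_pos (by omega), if_pos hk]
    rfl
  · rw [if_pos (by omega), if_neg (by omega), if_neg (by omega), if_pos hk, mul_assoc]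
    congr 1
    exact (mul_inv_cancel_left _ _).symm
  · rw [if_neg (by omega), if_neg (by omega), if_neg (by omega), if_neg (by omega)]
    rfl

theorem cechX_homog {n : ℕ} (f : Cochain p G n) :
    cechX (Fin 0 → Q) G (n + 1) (homog Q n f) = homog Q (n + 1) (d p G n f) := by
  funext q h
  rw [cechX_apply, cechD_def, Fin.sum_univ_succ]
  simp only [homog_apply, diff_removeNth_succ]
  simp only [d, LinearMap.coe_mk, AddHom.coe_mk, ContinuousMap.coe_mk]
  congr 1
  · simp [Fin.removeNth]
  · refine Finset.sum_congr rfl fun j _ => ?_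
    simp

theorem inflX_homog (π : G →ₜ* Q) {n : ℕ} (f : Cochain p Q n) :
    inflX (Fin 0 → Q) π (n + 1) (homog Q n f) = homog Q n (Cochain.pullback p π n f) := by
  funext q h
  simp [inflX_apply, homog_apply, Cochain.pullback]

theorem cupX_homog (π : G →ₜ* Q) {n : ℕ} (f : Cochain p Q n) {b : Cochain p G 1} {β : G → ZMod p}
    (hb : ∀ x y, b (fun _ => x⁻¹ * y) = β y - β x) :
    cupX (Fin 0 → Q) π β n (homog Q n f) =
      homog Q (n + 1) ((Cochain.pullback p π n f).cup rfl b) := by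
  funext q h
  rw [cupX_apply, homog_apply, homog_apply, ← hb]
  change _ = f _ * b _
  congr 2
  · funext i
    rw [map_mul, map_inv]
    rfl
  · funext i
    fin_cases i
    rfl

theorem mul_of_mem_cocycles {b : Cochain p G 1} (hb : b ∈ cocycles p G 1) (x y : G) :
    b (fun _ => x * y) = b (fun _ => x) + b (fun _ => y) := by
  have h := DFunLike.congr_fun (show d p G 1 b = 0 from hb) ![x, y]
  simp only [d, LinearMap.coe_mk, AddHom.coe_mk, ContinuousMap.coe_mk] at h
  erw [Fin.sum_univ_two] at h
  have h1 : (fun i : Fin 1 => ![x, y] i.succ) = fun _ => y := by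
    funext i
    fin_cases i
    rfl
  have h2 : Fin.contractNth 0 (· * ·) ![x, y] = fun _ => x * y := by
    funext i
    fin_cases i
    rfl
  have h3 : Fin.contractNth 1 (· * ·) ![x, y] = fun _ => x := by
    funext i
    fin_cases i
    rfl
  rw [h1, h2, h3] at h
  simp at h
  linear_combination -h

variable [Fact p.Prime] (D : PadicFibration p G Q) {b : Cochain p G 1}
  (hb : b ∈ cocycles p G 1) (hbγ : b (fun _ => D.γ) = 1)

include hb in
theorem inv_mul_of_mem_cocycles (x y : G) :
    b (fun _ => x⁻¹ * y) = b (fun _ => y) - b (fun _ => x) := by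
  rw [eq_sub_iff_add_eq, add_comm, ← mul_of_mem_cocycles hb, mul_inv_cancel_left]

include hb hbγ

theorem cone_exact_of_cocycle :
    (∀ x ∈ coneHom (Fin 0 → Q) D.π 0, coneD (Fin 0 → Q) D.π (fun g => b fun _ => g) 0 x = 0 →
      ∃ y ∈ homCochains p (Fin 0 → Q) (ContinuousMonoidHom.id Q) 1, coneε _ D.π y = x) ∧
    ∀ n, ∀ x ∈ coneHom (Fin 0 → Q) D.π (n + 1),
      coneD (Fin 0 → Q) D.π (fun g => b fun _ => g) (n + 1) x = 0 →
      ∃ y ∈ coneHom (Fin 0 → Q) D.π n, coneD _ D.π (fun g => b fun _ => g) n y = x :=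
  cone_exact D (b.continuous.comp (continuous_pi fun _ => continuous_id))
    (fun x y => mul_of_mem_cocycles hb x y) hbγ

theorem exists_pullback_eq {h : Cochain p G 0} (hh : h ∈ cocycles p G 0) :
    ∃ f ∈ cocycles p Q 0, Cochain.pullback p D.π 0 f = h := by
  obtain ⟨y, hy, hyh⟩ := (cone_exact_of_cocycle D hb hbγ).1 (homog Q 0 h, 0, 0)
    (mem_coneHom.2 ⟨homog_mem _ _, zero_mem _, zero_mem _⟩) (by
      simp only [coneD_apply, map_zero, cechX_homog, show d p G 0 h = 0 from hh, add_zero, sub_self]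
      rfl)
  obtain ⟨f, rfl⟩ := exists_homog_eq hy
  rw [coneε_apply, Prod.mk.injEq, Prod.mk.injEq, inflX_homog, cechX_homog] at hyh
  exact ⟨f, homog_injective (Q := Q) (hyh.2.1.trans (map_zero _).symm),
    homog_injective (Q := Q) hyh.1⟩

/-- A cocycle `h` gives the cycle `(h, 0, 0)` of the cone; its components as a boundary are the
required data. -/
theorem exists_pullback_add_cup_add_d_eq {n : ℕ} {h : Cochain p G (n + 1)}
    (hh : h ∈ cocycles p G (n + 1)) :
    ∃ f ∈ cocycles p Q (n + 1), ∃ g ∈ cocycles p Q n, ∃ e : Cochain p G n,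
      Cochain.pullback p D.π (n + 1) f + (Cochain.pullback p D.π n g).cup rfl b + d p G n e = h := by
  obtain ⟨⟨e, f, g⟩, hy, hyh⟩ := (cone_exact_of_cocycle D hb hbγ).2 n (homog Q (n + 1) h, 0, 0)
    (mem_coneHom.2 ⟨homog_mem _ _, zero_mem _, zero_mem _⟩) (by
      simp only [coneD_apply, map_zero, cechX_homog, show d p G (n + 1) h = 0 from hh, add_zero,
        sub_self]
      rfl)
  rw [mem_coneHom] at hy
  dsimp only at hy
  obtain ⟨e, rfl⟩ := exists_homog_eq hy.1
  obtain ⟨f, rfl⟩ := exists_homog_eq hy.2.1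
  obtain ⟨g, rfl⟩ := exists_homog_eq hy.2.2
  rw [coneD_apply, Prod.mk.injEq, Prod.mk.injEq] at hyh
  dsimp only at hyh
  rw [inflX_homog, cechX_homog, cechX_homog, cechX_homog,
    cupX_homog _ _ (inv_mul_of_mem_cocycles hb), ← map_add, ← map_sub] at hyh
  refine ⟨f, homog_injective (Q := Q) (hyh.2.1.trans (map_zero _).symm), g,
    homog_injective (Q := Q) (hyh.2.2.trans (map_zero _).symm), -e, ?_⟩
  rw [map_neg, ← sub_eq_add_neg]
  exact homog_injective (Q := Q) hyh.1

/-- The relation says that `(e, f, g)` is a cycle of the cone, and writing it as a boundary exhibits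
primitives. For `n = 0` the augmentation has last component zero, so `g = 0`. -/
theorem mem_coboundaries_of_pullback_add_cup {n : ℕ} {f : Cochain p Q (n + 1)}
    (hf : f ∈ cocycles p Q (n + 1)) {g : Cochain p Q n} (hg : g ∈ cocycles p Q n)
    {e : Cochain p G n} (he : Cochain.pullback p D.π (n + 1) f +
      (Cochain.pullback p D.π n g).cup rfl b = d p G n e) :
    f ∈ coboundaries p Q (n + 1) ∧ g ∈ coboundaries p Q n := by
  have hz : (homog Q n e, homog Q (n + 1) f, homog Q n g) ∈ coneHom (Fin 0 → Q) D.π n :=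
    mem_coneHom.2 ⟨homog_mem _ _, homog_mem _ _, homog_mem _ _⟩
  have hd : coneD (Fin 0 → Q) D.π (fun g => b fun _ => g) n
      (homog Q n e, homog Q (n + 1) f, homog Q n g) = 0 := by
    simp only [coneD_apply]
    rw [inflX_homog, cechX_homog, cechX_homog, cechX_homog,
      cupX_homog _ _ (inv_mul_of_mem_cocycles hb), ← map_add, he, sub_self,
      show d p Q (n + 1) f = 0 from hf, show d p Q n g = 0 from hg, map_zero, map_zero]
    rfl
  cases n with
  | zero =>
    obtain ⟨y, hy, hyh⟩ := (cone_exact_of_cocycle D hb hbγ).1 _ hz hd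
    obtain ⟨y, rfl⟩ := exists_homog_eq hy
    rw [coneε_apply, Prod.mk.injEq, Prod.mk.injEq, cechX_homog] at hyh
    exact ⟨⟨y, homog_injective (Q := Q) hyh.2.1⟩,
      homog_injective (Q := Q) (hyh.2.2.symm.trans (map_zero _).symm)⟩
  | succ n =>
    obtain ⟨⟨e', f', g'⟩, hy, hyh⟩ := (cone_exact_of_cocycle D hb hbγ).2 _ _ hz hd
    rw [mem_coneHom] at hy
    dsimp only at hy
    obtain ⟨f', rfl⟩ := exists_homog_eq hy.2.1
    obtain ⟨g', rfl⟩ := exists_homog_eq hy.2.2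
    rw [coneD_apply, Prod.mk.injEq, Prod.mk.injEq] at hyh
    dsimp only at hyh
    rw [cechX_homog, cechX_homog] at hyh
    exact ⟨⟨f', homog_injective (Q := Q) hyh.2.1⟩, ⟨g', homog_injective (Q := Q) hyh.2.2⟩⟩

end Gysin

section GysinCohomology

variable {p : ℕ} {G Q : Type*} [Group G] [TopologicalSpace G] [IsTopologicalGroup G]
  [Group Q] [TopologicalSpace Q] [IsTopologicalGroup Q]

/-- The class of a cocycle. -/
def cls {n : ℕ} (f : Cochain p G n) (hf : f ∈ cocycles p G n) : H p G n :=
  Submodule.Quotient.mk ⟨f, hf⟩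

theorem exists_cls_eq {n : ℕ} (x : H p G n) : ∃ f hf, cls f hf = x := by
  obtain ⟨⟨f, hf⟩, rfl⟩ := Submodule.Quotient.mk_surjective _ x
  exact ⟨f, hf, rfl⟩

theorem cls_eq_zero {n : ℕ} {f : Cochain p G n} {hf : f ∈ cocycles p G n} :
    cls f hf = 0 ↔ f ∈ coboundaries p G n := by
  rw [cls, Submodule.Quotient.mk_eq_zero]
  rfl

theorem pullback_mem_cocycles (φ : G →ₜ* Q) {n : ℕ} {f : Cochain p Q n} (hf : f ∈ cocycles p Q n) :
    Cochain.pullback p φ n f ∈ cocycles p G n := by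
  have hf' : d p Q n f = 0 := hf
  change d p G n _ = 0
  rw [d_pullback, hf', map_zero]

theorem map_cls (φ : G →ₜ* Q) {n : ℕ} {f : Cochain p Q n} (hf : f ∈ cocycles p Q n) :
    map p φ n (cls f hf) = cls (Cochain.pullback p φ n f) (pullback_mem_cocycles φ hf) := rfl

theorem cup_cls {a b c : ℕ} (h : a + b = c) {f : Cochain p G a} (hf : f ∈ cocycles p G a)
    {g : Cochain p G b} (hg : g ∈ cocycles p G b) :
    cup h (cls f hf) (cls g hg) = cls (f.cup h g) (cup_mem_cocycles h hf hg) := rfl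

theorem cls_add {n : ℕ} {f g : Cochain p G n} (hf : f ∈ cocycles p G n) (hg : g ∈ cocycles p G n) :
    cls f hf + cls g hg = cls (f + g) (add_mem hf hg) := rfl

theorem cls_eq_cls {n : ℕ} {f g : Cochain p G n} {hf : f ∈ cocycles p G n}
    {hg : g ∈ cocycles p G n} : cls f hf = cls g hg ↔ f - g ∈ coboundaries p G n := by
  rw [cls, cls, Submodule.Quotient.eq]
  rfl

/-- `(y, z) ↦ inf y + inf z ∪ β`. -/
def gysin (π : G →ₜ* Q) (β : H p G 1) (n : ℕ) :
    (H p Q (n + 1) × H p Q n) →ₗ[ZMod p] H p G (n + 1) :=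
  (map p π (n + 1)).coprod ((cup rfl).flip β ∘ₗ map p π n)

theorem gysin_apply (π : G →ₜ* Q) (β : H p G 1) (n : ℕ) (y : H p Q (n + 1)) (z : H p Q n) :
    gysin π β n (y, z) = map p π (n + 1) y + cup rfl (map p π n z) β := rfl

variable [Fact p.Prime] (D : PadicFibration p G Q) {b : Cochain p G 1}
  (hb : b ∈ cocycles p G 1) (hbγ : b (fun _ => D.γ) = 1)

include hbγ

theorem gysin_bijective (n : ℕ) : Function.Bijective (gysin D.π (cls b hb) n) := by
  constructor
  · refine (injective_iff_map_eq_zero _).2 fun ⟨y, z⟩ h => ?_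
    obtain ⟨f, hf, rfl⟩ := exists_cls_eq y
    obtain ⟨g, hg, rfl⟩ := exists_cls_eq z
    rw [gysin_apply, map_cls, map_cls, cup_cls, cls_add, cls_eq_zero] at h
    obtain ⟨e, he⟩ := h
    obtain ⟨h1, h2⟩ := mem_coboundaries_of_pullback_add_cup D hb hbγ hf hg he.symm
    exact Prod.ext (cls_eq_zero.2 h1) (cls_eq_zero.2 h2)
  · intro x
    obtain ⟨h, hh, rfl⟩ := exists_cls_eq x
    obtain ⟨f, hf, g, hg, e, he⟩ := exists_pullback_add_cup_add_d_eq D hb hbγ hh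
    refine ⟨(cls f hf, cls g hg), ?_⟩
    rw [gysin_apply, map_cls, map_cls, cup_cls, cls_add, cls_eq_cls, ← he]
    refine ⟨-e, ?_⟩
    rw [map_neg]
    abel

include hb in
theorem map_zero_surjective : Function.Surjective (map p D.π 0) := by
  intro x
  obtain ⟨h, hh, rfl⟩ := exists_cls_eq x
  obtain ⟨f, hf, rfl⟩ := exists_pullback_eq D hb hbγ hh
  exact ⟨cls f hf, rfl⟩

end GysinCohomology

/-! ### Functoriality of iterated cup products -/

section Functoriality

variable {p : ℕ} {G G' Q : Type*} [Group G] [TopologicalSpace G] [IsTopologicalGroup G]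
  [Group G'] [TopologicalSpace G'] [IsTopologicalGroup G']
  [Group Q] [TopologicalSpace Q] [IsTopologicalGroup Q]

theorem map_comp (φ : G →ₜ* G') (ψ : G' →ₜ* Q) (n : ℕ) (x : H p Q n) :
    map p φ n (map p ψ n x) = map p (ψ.comp φ) n x := by
  obtain ⟨f, hf, rfl⟩ := exists_cls_eq x
  rfl

theorem map_id (n : ℕ) (x : H p G n) : map p (ContinuousMonoidHom.id G) n x = x := by
  obtain ⟨f, hf, rfl⟩ := exists_cls_eq x
  rfl

theorem map_cup (φ : G →ₜ* G') {a b c : ℕ} (h : a + b = c) (x : H p G' a) (y : H p G' b) :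
    map p φ c (cup h x y) = cup h (map p φ a x) (map p φ b y) := by
  obtain ⟨f, hf, rfl⟩ := exists_cls_eq x
  obtain ⟨g, hg, rfl⟩ := exists_cls_eq y
  rfl

/-- The map `x ↦ inf(x) ∪ β₁ ∪ ⋯ ∪ β_j`. -/
def icup (π : G →ₜ* Q) {k j i : ℕ} (h : k + j = i) (β : Fin j → H p G 1) :
    H p Q k →ₗ[ZMod p] H p G i :=
  (degreeCast p G h).toLinearMap ∘ₗ iteratedCup j β ∘ₗ map p π k

theorem icup_zero (π : G →ₜ* Q) {k : ℕ} (β : Fin 0 → H p G 1) (x : H p Q k) :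
    icup π (Nat.add_zero k) β x = map p π k x := rfl

theorem icup_succ (π : G →ₜ* Q) {k j i : ℕ} (h : k + j = i) (h' : k + (j + 1) = i + 1)
    (β : Fin (j + 1) → H p G 1) (x : H p Q k) :
    icup π h' β x = cup rfl (icup π h (Fin.init β) x) (β (Fin.last j)) := by
  subst h
  rfl

theorem map_icup (ρ : G' →ₜ* G) (π : G →ₜ* Q) {k j i : ℕ} (h : k + j = i) (β : Fin j → H p G 1)
    (x : H p Q k) :
    map p ρ i (icup π h β x) = icup (π.comp ρ) h (fun t => map p ρ 1 (β t)) x := by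
  induction j generalizing i with
  | zero =>
    subst h
    exact map_comp ρ π _ x
  | succ j ih =>
    subst h
    rw [icup_succ π rfl rfl, icup_succ (π.comp ρ) rfl rfl, map_cup, ih]
    rfl

/-- In the limit argument this kills products involving a coordinate outside the chosen finite set.
-/
theorem icup_eq_zero (π : G →ₜ* Q) {k j i : ℕ} (h : k + j = i) {β : Fin j → H p G 1} {t : Fin j}
    (ht : β t = 0) (x : H p Q k) : icup π h β x = 0 := by
  induction j generalizing i with
  | zero => exact t.elim0
  | succ j ih =>
    subst h
    rw [icup_succ π rfl rfl]
    induction t using Fin.lastCases with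
    | last => rw [ht, map_zero]
    | cast t => rw [ih rfl (β := Fin.init β) ht, map_zero, LinearMap.zero_apply]

end Functoriality

/-! ## Decompositions -/

section Decomposition

variable {p : ℕ} {G Q B L : Type*} [Group G] [TopologicalSpace G] [IsTopologicalGroup G]
  [Group Q] [TopologicalSpace Q] [IsTopologicalGroup Q]
  [Group B] [TopologicalSpace B] [IsTopologicalGroup B] [LinearOrder L]

/-- `H^*(G)` is the direct sum of the injective images of `H^*(B)` under
`x ↦ inf(x) ∪ β_{l₁} ∪ ⋯ ∪ β_{l_j}`, for `l₁ < ⋯ < l_j` in `S`. -/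
structure Decomposes (π : G →ₜ* B) (β : L → H p G 1) (S : Set L) : Prop where
  span : ∀ (i : ℕ) (x : H p G i), x ∈ Submodule.span (ZMod p) {z | ∃ (k j : ℕ) (h : k + j = i)
    (s : Fin j ↪o L) (y : H p B k), Set.range s ⊆ S ∧ icup π h (fun t => β (s t)) y = z}
  proj : ∀ (k j i : ℕ) (h : k + j = i) (s : Fin j ↪o L), Set.range s ⊆ S →
    ∃ c : H p G i →ₗ[ZMod p] H p B k, (∀ y, c (icup π h (fun t => β (s t)) y) = y) ∧
      ∀ (k' j' : ℕ) (h' : k' + j' = i) (s' : Fin j' ↪o L), Set.range s' ⊆ S →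
        Set.range s' ≠ Set.range s → ∀ y, c (icup π h' (fun t => β (s' t)) y) = 0

/-- This starts the induction: with no coordinates, only the empty product occurs. -/
theorem Decomposes.of_inverse {π : G →ₜ* B} {τ : B →ₜ* G} (h1 : π.comp τ = ContinuousMonoidHom.id B)
    (h2 : τ.comp π = ContinuousMonoidHom.id G) (β : L → H p G 1) : Decomposes π β ∅ where
  span i x := by
    refine Submodule.subset_span ⟨i, 0, rfl, OrderEmbedding.ofIsEmpty, map p τ i x, ?_, ?_⟩
    · simp
    · rw [icup_zero, map_comp, h2, map_id]
  proj k j i h s hs := by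
    have hj : j = 0 := by
      by_contra hj
      exact hs ⟨⟨0, Nat.pos_of_ne_zero hj⟩, rfl⟩
    subst hj
    subst h
    refine ⟨map p τ k, fun y => ?_, fun k' j' h' s' hs' hne => ?_⟩
    · rw [icup_zero, map_comp, h1, map_id]
    · exact absurd ((Set.subset_empty_iff.1 hs').trans (Set.subset_empty_iff.1 hs).symm) hne

/-- Appending a larger element to an increasing sequence. -/
def snocEmb {j : ℕ} (s : Fin j ↪o L) (a : L) (h : ∀ t, s t < a) : Fin (j + 1) ↪o L :=
  OrderEmbedding.ofStrictMono (Fin.snoc (α := fun _ => L) s a) (by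
    intro x y hxy
    induction y using Fin.lastCases with
    | last =>
      induction x using Fin.lastCases with
      | last => exact absurd hxy (lt_irrefl _)
      | cast x => simpa using h x
    | cast y =>
      induction x using Fin.lastCases with
      | last => exact absurd hxy (Fin.castSucc_lt_last y).not_gt
      | cast x => simpa using hxy)

theorem snocEmb_last {j : ℕ} (s : Fin j ↪o L) (a : L) (h : ∀ t, s t < a) :
    snocEmb s a h (Fin.last j) = a :=
  Fin.snoc_last (α := fun _ => L) a s

theorem snocEmb_castSucc {j : ℕ} (s : Fin j ↪o L) (a : L) (h : ∀ t, s t < a) (t : Fin j) :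
    snocEmb s a h t.castSucc = s t :=
  Fin.snoc_castSucc (α := fun _ => L) a s t

/-- Removing the largest element of an increasing sequence. -/
def initEmb {j : ℕ} (s : Fin (j + 1) ↪o L) : Fin j ↪o L := Fin.castSuccOrderEmb.trans s

theorem range_eq_insert {j : ℕ} (s : Fin (j + 1) ↪o L) :
    Set.range s = insert (s (Fin.last j)) (Set.range (initEmb s)) := by
  ext x
  constructor
  · rintro ⟨t, rfl⟩
    induction t using Fin.lastCases with
    | last => exact Or.inl rfl
    | cast t => exact Or.inr ⟨t, rfl⟩
  · rintro (rfl | ⟨t, rfl⟩)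
    exacts [⟨_, rfl⟩, ⟨_, rfl⟩]

variable {a : L} {S : Set L}

theorem last_eq_of_mem {j : ℕ} {s : Fin (j + 1) ↪o L} (hs : Set.range s ⊆ insert a S)
    (ha : ∀ l ∈ S, l < a) (has : a ∈ Set.range s) :
    s (Fin.last j) = a ∧ Set.range (initEmb s) ⊆ S := by
  have h1 : s (Fin.last j) = a := by
    obtain ⟨t, ht⟩ := has
    rcases hs ⟨Fin.last j, rfl⟩ with h | h
    · exact h
    · have h2 := ha _ h
      rw [← ht, s.lt_iff_lt] at h2
      exact absurd h2 (Fin.le_last t).not_gt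
  refine ⟨h1, ?_⟩
  rintro _ ⟨t, rfl⟩
  refine (hs ⟨t.castSucc, rfl⟩).resolve_left fun h => ?_
  exact (Fin.castSucc_lt_last t).ne (s.injective (h.trans h1.symm))

theorem subset_of_notMem {j : ℕ} {s : Fin j ↪o L} (hs : Set.range s ⊆ insert a S)
    (has : a ∉ Set.range s) : Set.range s ⊆ S := fun _ hx =>
  (hs hx).resolve_left fun h => has (h ▸ hx)

variable [Fact p.Prime] (D : PadicFibration p G Q) {b : Cochain p G 1}
  (hb : b ∈ cocycles p G 1) (hbγ : b (fun _ => D.γ) = 1)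

-- Since `a` exceeds all of `S`, it can only be the last factor of a product. Products without `a`
-- fill the first summand of the Gysin decomposition, and products ending in `a` fill the second.
include hbγ in
theorem Decomposes.insert {π : Q →ₜ* B} {βQ : L → H p Q 1} {βG : L → H p G 1}
    (hd : Decomposes π βQ S) (ha : ∀ l ∈ S, l < a) (hS : ∀ l ∈ S, map p D.π 1 (βQ l) = βG l)
    (hβa : βG a = cls b hb) : Decomposes (π.comp D.π) βG (insert a S) := by
  have hmap : ∀ {k j i : ℕ} (h : k + j = i) (s : Fin j ↪o L) (y : H p B k), Set.range s ⊆ S →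
      icup (π.comp D.π) h (fun t => βG (s t)) y =
        map p D.π i (icup π h (fun t => βQ (s t)) y) := by
    intro k j i h s y hs
    rw [map_icup]
    congr 2
    funext t
    exact (hS _ (hs ⟨t, rfl⟩)).symm
  have hcup : ∀ {k j i : ℕ} (h : k + j = i) (h' : k + (j + 1) = i + 1) (s : Fin (j + 1) ↪o L)
      (y : H p B k), s (Fin.last j) = a → Set.range (initEmb s) ⊆ S →
      icup (π.comp D.π) h' (fun t => βG (s t)) y =
        gysin D.π (cls b hb) i (0, icup π h (fun t => βQ (initEmb s t)) y) := by
    intro k j i h h' s y hsa hs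
    rw [icup_succ _ h h', gysin_apply, map_zero, zero_add, ← hmap h _ y hs, hsa, hβa]
    rfl
  have hcup0 : ∀ {k j i : ℕ} (h : k + j = i + 1) (s : Fin j ↪o L) (y : H p B k),
      Set.range s ⊆ S → icup (π.comp D.π) h (fun t => βG (s t)) y =
        gysin D.π (cls b hb) i (icup π h (fun t => βQ (s t)) y, 0) := by
    intro k j i h s y hs
    rw [gysin_apply, map_zero, map_zero, LinearMap.zero_apply, add_zero, hmap h s y hs]
  constructor
  · intro i x
    set T := Submodule.span (ZMod p) {z : H p G i | ∃ (k j : ℕ) (h : k + j = i)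
      (s : Fin j ↪o L) (y : H p B k), Set.range s ⊆ Insert.insert a S ∧
        icup (π.comp D.π) h (fun t => βG (s t)) y = z} with hT
    have h1 : ∀ y : H p Q i, map p D.π i y ∈ T := by
      intro y
      have := hd.span i y
      refine (Submodule.span_le (p := T.comap (map p D.π i))).2 ?_ this
      rintro _ ⟨k, j, h, s, y, hs, rfl⟩
      exact Submodule.subset_span ⟨k, j, h, s, y, hs.trans (Set.subset_insert _ _), hmap h s y hs⟩
    cases i with
    | zero =>
      obtain ⟨y, rfl⟩ := map_zero_surjective D hb hbγ x
      exact h1 y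
    | succ i =>
      obtain ⟨⟨y, z⟩, rfl⟩ := (gysin_bijective D hb hbγ i).2 x
      have h2 : gysin D.π (cls b hb) i (0, z) ∈ T := by
        have := hd.span i z
        refine (Submodule.span_le (p := T.comap (gysin D.π (cls b hb) i ∘ₗ
          LinearMap.inr (ZMod p) _ _))).2 ?_ this
        rintro _ ⟨k, j, h, s, y, hs, rfl⟩
        have hsa : ∀ t, s t < a := fun t => ha _ (hs ⟨t, rfl⟩)
        have hi : initEmb (snocEmb s a hsa) = s := by
          ext t
          exact snocEmb_castSucc s a hsa t
        refine Submodule.subset_span ⟨k, j + 1, by omega, snocEmb s a hsa, y, ?_, ?_⟩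
        · rw [range_eq_insert, hi, snocEmb_last]
          exact Set.insert_subset_insert hs
        · rw [hcup h (by omega) _ y (snocEmb_last s a hsa) (hi.symm ▸ hs), hi]
          rfl
      have h3 : gysin D.π (cls b hb) i (y, z) =
          map p D.π (i + 1) y + gysin D.π (cls b hb) i (0, z) := by
        rw [gysin_apply, gysin_apply, map_zero, zero_add]
      rw [h3]
      exact add_mem (h1 y) h2
  · intro k j i h s hs
    by_cases has : a ∈ Set.range s
    · cases j with
      | zero => exact has.choose.elim0
      | succ j =>
        obtain ⟨i, rfl⟩ : ∃ i', i = i' + 1 := ⟨k + j, h.symm⟩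
        obtain ⟨hsa, hs0⟩ := last_eq_of_mem hs ha has
        obtain ⟨c, hc1, hc2⟩ := hd.proj k j i (by omega) (initEmb s) hs0
        -- The retraction for a sequence ending in `a` is the second Gysin component followed by the
        -- retraction for the shortened sequence.
        let e := LinearEquiv.ofBijective _ (gysin_bijective D hb hbγ i)
        have he : ∀ z, e.symm (gysin D.π (cls b hb) i z) = z := e.symm_apply_apply
        refine ⟨c ∘ₗ LinearMap.snd (ZMod p) _ _ ∘ₗ e.symm.toLinearMap, fun y => ?_,
          fun k' j' h' s' hs' hne y => ?_⟩
        · rw [hcup (by omega) h s y hsa hs0]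
          simp only [LinearMap.comp_apply, LinearEquiv.coe_coe, he]
          exact hc1 y
        · by_cases has' : a ∈ Set.range s'
          · cases j' with
            | zero => exact has'.choose.elim0
            | succ j' =>
              obtain ⟨hsa', hs0'⟩ := last_eq_of_mem hs' ha has'
              rw [hcup (by omega) h' s' y hsa' hs0']
              simp only [LinearMap.comp_apply, LinearEquiv.coe_coe, he]
              refine hc2 _ _ _ _ hs0' (fun heq => hne ?_) y
              rw [range_eq_insert, range_eq_insert, hsa, hsa', heq]
          · rw [hcup0 h' s' y (subset_of_notMem hs' has')]
            simp only [LinearMap.comp_apply, LinearEquiv.coe_coe, he]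
            exact map_zero c
    · have hs0 := subset_of_notMem hs has
      obtain ⟨c, hc1, hc2⟩ := hd.proj k j i h s hs0
      cases i with
      | zero =>
        -- Gysin describes positive degrees only. In degree zero, inflation is injective because
        -- `inf y ∪ β` already determines `y`, and a linear left inverse serves as retraction.
        have hinj : Function.Injective (map p D.π 0) := by
          refine (injective_iff_map_eq_zero _).2 fun y hy => ?_
          have := (gysin_bijective D hb hbγ 0).1 (a₁ := (0, y)) (a₂ := 0) (by
            rw [gysin_apply, hy, map_zero, map_zero, map_zero, LinearMap.zero_apply, add_zero])
          exact congrArg Prod.snd this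
        obtain ⟨r, hr⟩ := LinearMap.exists_leftInverse_of_injective _ (LinearMap.ker_eq_bot.2 hinj)
        have hr' : ∀ y, r (map p D.π 0 y) = y := LinearMap.congr_fun hr
        refine ⟨c ∘ₗ r, fun y => ?_, fun k' j' h' s' hs' hne y => ?_⟩
        · rw [hmap h s y hs0, LinearMap.comp_apply, hr', hc1]
        · obtain rfl : j' = 0 := by omega
          have hs0' : Set.range s' ⊆ S := by simp
          rw [hmap h' s' y hs0', LinearMap.comp_apply, hr', hc2 _ _ _ _ hs0' hne]
      | succ i =>
        let e := LinearEquiv.ofBijective _ (gysin_bijective D hb hbγ i)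
        have he : ∀ z, e.symm (gysin D.π (cls b hb) i z) = z := e.symm_apply_apply
        refine ⟨c ∘ₗ LinearMap.fst (ZMod p) _ _ ∘ₗ e.symm.toLinearMap, fun y => ?_,
          fun k' j' h' s' hs' hne y => ?_⟩
        · rw [hcup0 h s y hs0]
          simp only [LinearMap.comp_apply, LinearEquiv.coe_coe, he]
          exact hc1 y
        · by_cases has' : a ∈ Set.range s'
          · cases j' with
            | zero => exact has'.choose.elim0
            | succ j' =>
              obtain ⟨hsa', hs0'⟩ := last_eq_of_mem hs' ha has'
              rw [hcup (by omega) h' s' y hsa' hs0']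
              simp only [LinearMap.comp_apply, LinearEquiv.coe_coe, he]
              exact map_zero c
          · have hs0' := subset_of_notMem hs' has'
            rw [hcup0 h' s' y hs0']
            simp only [LinearMap.comp_apply, LinearEquiv.coe_coe, he]
            exact hc2 _ _ _ _ hs0' hne y

end Decomposition

/-! ### Passage to infinitely many coordinates -/

section Limit

variable {p : ℕ} {G B L : Type*} [Group G] [TopologicalSpace G] [IsTopologicalGroup G]
  [Group B] [TopologicalSpace B] [IsTopologicalGroup B] [LinearOrder L]
  {K : Finset L → Type*} [∀ S, Group (K S)] [∀ S, TopologicalSpace (K S)]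
  [∀ S, IsTopologicalGroup (K S)]

/-- The groups `K S` approximate `G`. Spanning holds because each class is inflated from some `K S`;
a retraction is obtained by restricting to the `K S` whose coordinates are those of the given
sequence. -/
theorem Decomposes.of_forall_finset {π : G →ₜ* B} {β : L → H p G 1} (πS : ∀ S, K S →ₜ* B)
    (ρ : ∀ S, G →ₜ* K S) (σ : ∀ S, K S →ₜ* G) (βS : ∀ S, L → H p (K S) 1)
    (hd : ∀ S : Finset L, Decomposes (πS S) (βS S) (S : Set L))
    (hρ : ∀ S, (πS S).comp (ρ S) = π) (hσ : ∀ S, π.comp (σ S) = πS S)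
    (hβρ : ∀ S, ∀ l ∈ S, map p (ρ S) 1 (βS S l) = β l)
    (hβσ : ∀ S l, map p (σ S) 1 (β l) = βS S l) (hβS : ∀ S, ∀ l ∉ S, βS S l = 0)
    (hlim : ∀ (i : ℕ) (x : H p G i), ∃ S, map p (ρ S) i (map p (σ S) i x) = x) :
    Decomposes π β Set.univ where
  span i x := by
    obtain ⟨S, hS⟩ := hlim i x
    rw [← hS]
    set T := Submodule.span (ZMod p) {z : H p G i | ∃ (k j : ℕ) (h : k + j = i)
      (s : Fin j ↪o L) (y : H p B k), Set.range s ⊆ Set.univ ∧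
        icup π h (fun t => β (s t)) y = z} with hT
    refine (Submodule.span_le (p := T.comap (map p (ρ S) i))).2 ?_ ((hd S).span i (map p (σ S) i x))
    rintro _ ⟨k, j, h, s, y, hs, rfl⟩
    refine Submodule.subset_span ⟨k, j, h, s, y, Set.subset_univ _, ?_⟩
    rw [map_icup, hρ]
    congr 2
    funext t
    exact (hβρ S _ (hs ⟨t, rfl⟩)).symm
  proj k j i h s _ := by
    classical
    let S : Finset L := Finset.univ.image s
    have hs : Set.range s ⊆ (S : Set L) := by
      rintro _ ⟨t, rfl⟩
      simp [S]
    obtain ⟨c, hc1, hc2⟩ := (hd S).proj k j i h s hs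
    refine ⟨c ∘ₗ map p (σ S) i, fun y => ?_, fun k' j' h' s' _ hne y => ?_⟩
    · rw [LinearMap.comp_apply, map_icup, hσ]
      simp only [hβσ]
      exact hc1 y
    · rw [LinearMap.comp_apply, map_icup, hσ]
      simp only [hβσ]
      -- A competing product either lies in `S`, where the finite retraction kills it, or contains a
      -- class that already restricts to zero.
      by_cases hs' : Set.range s' ⊆ (S : Set L)
      · exact hc2 _ _ _ _ hs' hne y
      · obtain ⟨_, ⟨t, rfl⟩, ht⟩ := Set.not_subset.1 hs'
        rw [icup_eq_zero _ h' (t := t) (hβS S _ ht), map_zero]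

end Limit

theorem mem_cocycles_of_mul {p : ℕ} {G : Type*} [Group G] [TopologicalSpace G]
    [IsTopologicalGroup G] {b : Cochain p G 1}
    (hb : ∀ x y, b (fun _ => x * y) = b (fun _ => x) + b (fun _ => y)) : b ∈ cocycles p G 1 := by
  change d p G 1 b = 0
  ext x
  simp only [d, LinearMap.coe_mk, AddHom.coe_mk, ContinuousMap.coe_mk]
  erw [Fin.sum_univ_two]
  have h1 : (fun i : Fin 1 => x i.succ) = fun _ => x 1 := by
    funext i
    fin_cases i
    rfl
  have h2 : Fin.contractNth 0 (· * ·) x = fun _ => x 0 * x 1 := by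
    funext i
    fin_cases i
    rfl
  have h3 : Fin.contractNth 1 (· * ·) x = fun _ => x 0 := by
    funext i
    fin_cases i
    rfl
  rw [h1, h2, h3, hb]
  simp

end ProfiniteCohomology

/-! ### Extensions by `ℤ_p^κ` and the case of finitely many coordinates -/

/-- Reindexing of functions, as a continuous linear map. -/
def pullL (p : ℕ) [Fact p.Prime] {κ κ' : Type*} (f : κ → κ') :
    (κ' → ℤ_[p]) →L[ℤ_[p]] (κ → ℤ_[p]) where
  toLinearMap := LinearMap.funLeft ℤ_[p] ℤ_[p] f
  cont := continuous_pi fun i => continuous_apply (f i)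

/-- Extension by zero, as a continuous linear map. -/
def extL (p : ℕ) [Fact p.Prime] {κ κ' : Type*} (f : κ → κ') :
    (κ → ℤ_[p]) →L[ℤ_[p]] (κ' → ℤ_[p]) where
  toLinearMap := Function.ExtendByZero.linearMap ℤ_[p] f
  cont := by
    refine continuous_pi fun i => ?_
    change Continuous fun x : κ → ℤ_[p] => Function.extend f x 0 i
    by_cases h : ∃ j, f j = i
    · have h1 : (fun x : κ → ℤ_[p] => Function.extend f x 0 i) = fun x => x h.choose :=
        funext fun x => by classical exact dif_pos h
      rw [h1]
      exact continuous_apply _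
    · have h1 : (fun x : κ → ℤ_[p] => Function.extend f x 0 i) = fun _ => 0 :=
        funext fun x => Function.extend_apply' _ _ _ h
      rw [h1]
      exact continuous_const

namespace CyclotomicPair

open ProfiniteCohomology

variable {p : ℕ} [Fact p.Prime] {B : Type*} [Group B] [TopologicalSpace B] [IsTopologicalGroup B]
  (P : CyclotomicPair p B) {κ κ' : Type*}

theorem mul_left_toAdd (x y : P.Extension κ) : (x * y).left.toAdd =
    x.left.toAdd + ((P.θ x.right : ℤ_[p]ˣ) : ℤ_[p]) • y.left.toAdd := rfl

theorem extension_ext {x y : P.Extension κ} (h1 : ∀ i, x.left.toAdd i = y.left.toAdd i)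
    (h2 : x.right = y.right) : x = y :=
  SemidirectProduct.ext (Multiplicative.toAdd.injective (funext h1)) h2

theorem continuous_left_toAdd : Continuous fun x : P.Extension κ => x.left.toAdd :=
  continuous_toAdd.comp SemidirectProduct.continuous_left_right.fst

theorem continuous_right : Continuous fun x : P.Extension κ => x.right :=
  SemidirectProduct.continuous_left_right.snd

/-- Functoriality of the extension of `B` by `ℤ_p^κ`. -/
def extMap (T : (κ → ℤ_[p]) →L[ℤ_[p]] (κ' → ℤ_[p])) : P.Extension κ →ₜ* P.Extension κ' where
  toFun x := ⟨.ofAdd (T x.left.toAdd), x.right⟩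
  map_one' := P.extension_ext (fun i => congrFun (map_zero T) i) rfl
  map_mul' x y := by
    refine P.extension_ext (fun i => ?_) rfl
    rw [mul_left_toAdd]
    change T (x * y).left.toAdd i = (T x.left.toAdd +
      ((P.θ x.right : ℤ_[p]ˣ) : ℤ_[p]) • T y.left.toAdd) i
    rw [mul_left_toAdd, map_add, map_smul]
  continuous_toFun := continuous_induced_rng.2
    ((continuous_ofAdd.comp (T.continuous.comp P.continuous_left_toAdd)).prodMk P.continuous_right)

/-- Here the values of `θ` being `1`-units matters: the twist disappears modulo `p`, so reduced
coordinates are homomorphisms. -/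
theorem toZMod_θ (g : B) : PadicInt.toZMod ((P.θ g : ℤ_[p]ˣ) : ℤ_[p]) = 1 := by
  have h : ((P.θ g : ℤ_[p]ˣ) : ℤ_[p]) - 1 ∈ RingHom.ker (PadicInt.toZMod (p := p)) := by
    rw [PadicInt.ker_toZMod, PadicInt.maximalIdeal_eq_span_p, Ideal.mem_span_singleton]
    exact (P.θ g).2
  rw [RingHom.mem_ker, map_sub, map_one, sub_eq_zero] at h
  exact h

/-- The cocycle given by a coordinate modulo `p`. -/
def coordCocycle (i : κ) : Cochain p (P.Extension κ) 1 where
  toFun x := PadicInt.toZMod ((x 0).left.toAdd i)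
  continuous_toFun := (continuous_toZMod p).comp ((continuous_apply i).comp
    (P.continuous_left_toAdd.comp (continuous_apply 0)))

theorem coordCocycle_apply (i : κ) (x : Fin 1 → P.Extension κ) :
    P.coordCocycle i x = PadicInt.toZMod ((x 0).left.toAdd i) := rfl

theorem coordCocycle_mem (i : κ) : P.coordCocycle i ∈ cocycles p (P.Extension κ) 1 :=
  mem_cocycles_of_mul fun x y => by
    rw [coordCocycle_apply, mul_left_toAdd, Pi.add_apply, Pi.smul_apply, smul_eq_mul, map_add,
      map_mul, toZMod_θ, one_mul]
    rfl

/-- The projection `ℤ_p^κ' ⋊ B → ℤ_p^κ ⋊ B` that forgets one coordinate. -/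
def fibration [DecidableEq κ'] (f : κ → κ') (hf : Function.Injective f) (a : κ')
    (ha : ∀ x, x ∉ Set.range f ↔ x = a) :
    PadicFibration p (P.Extension κ') (P.Extension κ) where
  π := P.extMap (pullL p f)
  σ := (P.extMap (extL p f)).toContinuousMap
  ζ := ⟨⟨⟨fun z => ⟨.ofAdd (Pi.single a z.toAdd), 1⟩,
    P.extension_ext (fun i => congrFun (Pi.single_zero a) i) rfl⟩, fun z w => by
      refine P.extension_ext (fun i => ?_) (mul_one 1).symm
      rw [mul_left_toAdd]
      simp [Pi.single_add]⟩, continuous_induced_rng.2 ((continuous_ofAdd.comp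
        ((show Continuous fun z : ℤ_[p] => (Pi.single a z : κ' → ℤ_[p]) from
          (ContinuousLinearMap.single ℤ_[p] (fun _ : κ' => ℤ_[p]) a).continuous).comp continuous_toAdd)).prodMk continuous_const)⟩
  -- Right multiplication by `ζ z` adds `θ z` to the coordinate at `a`, so the coordinate along the
  -- kernel is divided by `θ`.
  coord := ⟨fun x => (((P.θ x.right : ℤ_[p]ˣ)⁻¹ : ℤ_[p]ˣ) : ℤ_[p]) * x.left.toAdd a,
    (Units.continuous_val.comp (continuous_subtype_val.comp
      (P.θ.continuous_toFun.comp P.continuous_right)).inv).mul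
      ((continuous_apply a).comp P.continuous_left_toAdd)⟩
  π_σ q := by
    refine P.extension_ext (fun i => ?_) rfl
    exact hf.extend_apply q.left.toAdd 0 i
  π_ζ z := by
    refine P.extension_ext (fun i => ?_) rfl
    have h : f i ≠ a := fun h => (ha a).2 rfl ⟨i, h⟩
    exact Pi.single_eq_of_ne h _
  coord_mul x := by
    change (((P.θ (x.right * 1) : ℤ_[p]ˣ)⁻¹ : ℤ_[p]ˣ) : ℤ_[p]) * (x.left.toAdd a +
      ((P.θ x.right : ℤ_[p]ˣ) : ℤ_[p]) * (Pi.single a (1 : ℤ_[p]) : κ' → ℤ_[p]) a) = _ + 1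
    rw [mul_one, Pi.single_eq_same, mul_one, mul_add, Units.inv_mul]
    rfl
  σ_mul_ζ x := by
    refine P.extension_ext (fun i => ?_) (mul_one _)
    change Function.extend f (fun j => x.left.toAdd (f j)) 0 i +
      ((P.θ x.right : ℤ_[p]ˣ) : ℤ_[p]) * (Pi.single a
        ((((P.θ x.right : ℤ_[p]ˣ)⁻¹ : ℤ_[p]ˣ) : ℤ_[p]) * x.left.toAdd a) : κ' → ℤ_[p]) i = _
    by_cases hi : i ∈ Set.range f
    · obtain ⟨j, rfl⟩ := hi
      have h : f j ≠ a := fun h => (ha a).2 rfl ⟨j, h⟩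
      rw [hf.extend_apply, Pi.single_eq_of_ne h, mul_zero, add_zero]
    · obtain rfl := (ha i).1 hi
      rw [Function.extend_apply' _ _ _ hi, Pi.single_eq_same, Units.mul_inv_cancel_left]
      exact zero_add _

variable {L : Type*} [LinearOrder L]

/-- The class of the coordinate at `l` if `l ∈ S`, and zero otherwise. -/
def coordClass (S : Finset L) (l : L) : H p (P.Extension S) 1 :=
  if h : l ∈ S then cls (P.coordCocycle ⟨l, h⟩) (P.coordCocycle_mem _) else 0

theorem coordClass_of_mem {S : Finset L} {l : L} (h : l ∈ S) :
    P.coordClass S l = cls (P.coordCocycle ⟨l, h⟩) (P.coordCocycle_mem _) := dif_pos h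

theorem coordClass_of_notMem {S : Finset L} {l : L} (h : l ∉ S) : P.coordClass S l = 0 := dif_neg h

theorem decomposes_finset (S : Finset L) :
    Decomposes (SemidirectProduct.rightHomₜ (P.action S)) (P.coordClass S) (S : Set L) := by
  -- The new index must be the largest, as iterated products grow on the right.
  induction S using Finset.induction_on_max with
  | empty =>
    rw [Finset.coe_empty]
    refine Decomposes.of_inverse (τ := SemidirectProduct.inrₜ (P.action _)) ?_ ?_ _
    · rfl
    · refine ContinuousMonoidHom.ext fun x => P.extension_ext (fun i => ?_) rfl
      exact absurd i.2 (Finset.notMem_empty _)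
  | insert a S ha ih =>
    let f : S → (insert a S : Finset L) := fun l => ⟨l.1, Finset.mem_insert_of_mem l.2⟩
    have hf : Function.Injective f := fun x y h => Subtype.ext (congrArg Subtype.val h :)
    have haS : a ∉ S := fun h => lt_irrefl _ (ha a h)
    let D := P.fibration f hf ⟨a, Finset.mem_insert_self a S⟩ (by
      rintro ⟨x, hx⟩
      rw [Subtype.mk.injEq]
      constructor
      · intro h
        refine (Finset.mem_insert.1 hx).resolve_right fun hxS => h ⟨⟨x, hxS⟩, rfl⟩
      · rintro rfl ⟨y, hy⟩
        have : y.1 = x := congrArg Subtype.val hy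
        exact haS (this ▸ y.2))
    have hD : (SemidirectProduct.rightHomₜ (P.action S)).comp D.π =
      SemidirectProduct.rightHomₜ (P.action (insert a S : Finset L)) := rfl
    rw [Finset.coe_insert, ← hD]
    refine ih.insert D (P.coordCocycle_mem ⟨a, Finset.mem_insert_self a S⟩) ?_
      (fun l hl => ha l hl) (fun l hl => ?_) (P.coordClass_of_mem _)
    · change PadicInt.toZMod ((Pi.single _ (1 : ℤ_[p]) : _ → ℤ_[p]) _) = 1
      rw [Pi.single_eq_same, map_one]
    · have hl' : l ∈ S := hl
      rw [P.coordClass_of_mem hl', P.coordClass_of_mem (Finset.mem_insert_of_mem hl'), map_cls]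
      rfl

end CyclotomicPair

/-! ## Isomorphisms of powers of `ℤ_p` -/

section Lattice

variable {p : ℕ} [Fact p.Prime] {ι κ : Type*}

/-- Reduction modulo `p` of the coordinates. -/
abbrev redP (a : ι → ℤ_[p]) : ι → ZMod p := fun i => PadicInt.toZMod (a i)

theorem toZMod_eq_zero_iff {x : ℤ_[p]} : PadicInt.toZMod x = 0 ↔ (p : ℤ_[p]) ∣ x := by
  rw [← RingHom.mem_ker, PadicInt.ker_toZMod, PadicInt.maximalIdeal_eq_span_p,
    Ideal.mem_span_singleton]

/-- A lift to `ℤ_p` of a row-finite matrix over `ℤ/p`. -/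
def liftL (N : κ → (ι →₀ ZMod p)) : (ι → ℤ_[p]) →L[ℤ_[p]] (κ → ℤ_[p]) :=
  ContinuousLinearMap.pi fun l =>
    ∑ i ∈ (N l).support, ((N l i).val : ℤ_[p]) • ContinuousLinearMap.proj i

theorem redP_liftL (N : κ → (ι →₀ ZMod p)) (a : ι → ℤ_[p]) (l : κ) :
    redP (liftL N a) l = Finsupp.linearCombination (ZMod p) (redP a) (N l) := by
  rw [Finsupp.linearCombination_apply, Finsupp.sum, redP, liftL]
  simp

theorem exists_eq_smul_of_redP_eq {a b : ι → ℤ_[p]} (h : redP a = redP b) :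
    ∃ c : ι → ℤ_[p], a = b + (p : ℤ_[p]) • c := by
  have h1 : ∀ i, (p : ℤ_[p]) ∣ a i - b i := fun i => by
    rw [← toZMod_eq_zero_iff, map_sub, sub_eq_zero]
    exact congrFun h i
  choose c hc using h1
  exact ⟨c, funext fun i => by simp [← hc]⟩

theorem norm_pow_mul_le (n : ℕ) (x : ℤ_[p]) : ‖(p : ℤ_[p]) ^ n * x‖ ≤ (p : ℝ)⁻¹ ^ n := by
  rw [norm_mul, norm_pow, PadicInt.norm_p]
  exact mul_le_of_le_one_right (by positivity) (PadicInt.norm_le_one x)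

theorem tendsto_inv_pow : Filter.Tendsto (fun n : ℕ => (p : ℝ)⁻¹ ^ n) Filter.atTop (nhds 0) :=
  tendsto_pow_atTop_nhds_zero_of_lt_one (by positivity)
    (inv_lt_one_of_one_lt₀ (by exact_mod_cast (Fact.out : p.Prime).one_lt))

/-- This is a Nakayama argument: `U` is the identity modulo `p`, and the modules are `p`-adically
separated and compact. -/
theorem bijective_of_redP_eq (U : (ι → ℤ_[p]) →L[ℤ_[p]] (ι → ℤ_[p]))
    (hU : ∀ a, redP (U a) = redP a) : Function.Bijective U := by
  have hp : (p : ℤ_[p]) ≠ 0 := by exact_mod_cast (Fact.out : p.Prime).ne_zero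
  constructor
  · refine (injective_iff_map_eq_zero U).2 fun a ha => ?_
    -- An element of the kernel is divisible by `p`, and its quotient by `p` is again in the kernel.
    have key : ∀ n : ℕ, ∀ a, U a = 0 → ∃ c : ι → ℤ_[p], a = (p : ℤ_[p]) ^ n • c := by
      intro n
      induction n with
      | zero => exact fun a _ => ⟨a, by simp⟩
      | succ n ih =>
        intro a ha
        obtain ⟨c, hc⟩ := exists_eq_smul_of_redP_eq (a := a) (b := 0) (by rw [← hU, ha])
        rw [zero_add] at hc
        rw [hc, map_smul] at ha
        obtain ⟨c', rfl⟩ := ih c ((smul_eq_zero.1 ha).resolve_left hp)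
        exact ⟨c', by rw [hc, smul_smul, pow_succ']⟩
    funext i
    rw [Pi.zero_apply, ← norm_eq_zero]
    refine le_antisymm (ge_of_tendsto' (tendsto_inv_pow (p := p)) fun n => ?_) (norm_nonneg _)
    obtain ⟨c, rfl⟩ := key n a ha
    exact norm_pow_mul_le n (c i)
  · intro y
    -- Successive approximation: the remainder `r` is its own preimage up to a multiple of `p`.
    -- Compactness of the image then gives exact preimages.
    have key : ∀ n : ℕ, ∃ x r : ι → ℤ_[p], y = U x + (p : ℤ_[p]) ^ n • r := by
      intro n
      induction n with
      | zero => exact ⟨0, y, by simp⟩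
      | succ n ih =>
        obtain ⟨x, r, h⟩ := ih
        obtain ⟨r', hr'⟩ := exists_eq_smul_of_redP_eq (hU r).symm
        refine ⟨x + (p : ℤ_[p]) ^ n • r, r', ?_⟩
        rw [map_add, map_smul, pow_succ, mul_smul, add_assoc, ← smul_add, ← hr', ← h]
    choose x r h using key
    have hcl : IsClosed (Set.range U) := (isCompact_range U.continuous).isClosed
    suffices hlim : Filter.Tendsto (fun n => U (x n)) Filter.atTop (nhds y) from
      hcl.mem_of_tendsto hlim (Filter.Eventually.of_forall fun n => ⟨x n, rfl⟩)
    refine tendsto_pi_nhds.2 fun i => tendsto_iff_norm_sub_tendsto_zero.2 ?_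
    refine squeeze_zero (fun _ => norm_nonneg _) (fun n => ?_) (tendsto_inv_pow (p := p))
    have h1 : U (x n) i - y i = -((p : ℤ_[p]) ^ n * r n i) := by
      have := congrFun (h n) i
      simp only [Pi.add_apply, Pi.smul_apply, smul_eq_mul] at this
      rw [this]
      ring
    rw [h1, norm_neg]
    exact norm_pow_mul_le n _

/-- A basis of the `𝔽_p`-vector space of finitely supported functions on `ι` gives coordinates on
`ℤ_p^ι`. -/
theorem exists_continuousLinearEquiv (bas : Module.Basis κ (ZMod p) (ι →₀ ZMod p)) :
    ∃ T : (ι → ℤ_[p]) ≃L[ℤ_[p]] (κ → ℤ_[p]), ∀ a l,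
      redP (T a) l = Finsupp.linearCombination (ZMod p) (redP a) (bas l) := by
  -- Entrywise lifts of the base change matrix and its inverse are not mutually inverse, but both
  -- composites are the identity modulo `p`.
  let N : κ → (ι →₀ ZMod p) := fun l => bas l
  let M : ι → (κ →₀ ZMod p) := fun i => bas.repr (Finsupp.single i 1)
  have h1 : ∀ a, redP ((liftL M ∘L liftL N) a) = redP a := fun a => by
    funext i
    rw [ContinuousLinearMap.comp_apply, redP_liftL]
    have : redP (liftL N a) = fun l => Finsupp.linearCombination (ZMod p) (redP a) (bas l) :=
      funext fun l => redP_liftL N a l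
    rw [this]
    have h2 := Finsupp.apply_linearCombination (R := ZMod p)
      (Finsupp.linearCombination (ZMod p) (redP a)) bas (M i)
    rw [bas.linearCombination_repr, Finsupp.linearCombination_single, one_smul] at h2
    exact h2.symm
  have h2 : ∀ x, redP ((liftL N ∘L liftL M) x) = redP x := fun x => by
    funext l
    rw [ContinuousLinearMap.comp_apply, redP_liftL]
    let φ : (ι →₀ ZMod p) →ₗ[ZMod p] ZMod p :=
      Finsupp.linearCombination (ZMod p) (redP x) ∘ₗ bas.repr.toLinearMap
    have : redP (liftL M x) = fun i => φ (Finsupp.single i 1) :=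
      funext fun i => redP_liftL M x i
    have h3 : Finsupp.linearCombination (ZMod p) (fun i => φ (Finsupp.single i 1)) = φ := by
      ext i
      simp
    rw [this, h3]
    simp [φ, N]
  have hb1 := bijective_of_redP_eq _ h1
  have hb2 := bijective_of_redP_eq _ h2
  have hb : Function.Bijective (liftL N) :=
    ⟨Function.Injective.of_comp (f := liftL M) hb1.1,
      Function.Surjective.of_comp (g := liftL M) hb2.2⟩
  let e : (ι → ℤ_[p]) ≃ₗ[ℤ_[p]] (κ → ℤ_[p]) := LinearEquiv.ofBijective (liftL N).toLinearMap hb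
  have he : Continuous e.toEquiv := (liftL N).continuous
  exact ⟨{ e with
    continuous_toFun := he
    continuous_invFun := (he.homeoOfEquivCompactToT2).symm.continuous }, fun a l => redP_liftL N a l⟩

end Lattice

/-! ## Continuous functions on products depend on finitely many coordinates -/

/-- Locally this is the definition of the product topology. Compactness makes the finite set
uniform, also in the parameter `t`. -/
theorem exists_finset_forall_eq {L K T M : Type*} [TopologicalSpace K] [CompactSpace K]
    [TopologicalSpace T] [CompactSpace T] [TopologicalSpace M] [DiscreteTopology M]
    {g : (L → K) × T → M} (hg : Continuous g) :
    ∃ S : Finset L, ∀ u u' t, (∀ l ∈ S, u' l = u l) → g (u', t) = g (u, t) := by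
  classical
  have key : ∃ S : Finset L, ∀ z ∈ (Set.univ : Set ((L → K) × T)), ∀ u',
      (∀ l ∈ S, u' l = z.1 l) → g (u', z.2) = g z := by
    refine isCompact_univ.induction_on (p := fun s => ∃ S : Finset L, ∀ z ∈ s, ∀ u',
      (∀ l ∈ S, u' l = z.1 l) → g (u', z.2) = g z) ?_ ?_ ?_ ?_
    · exact ⟨∅, fun z hz => absurd hz (Set.notMem_empty z)⟩
    · rintro s t hst ⟨S, hS⟩
      exact ⟨S, fun z hz => hS z (hst hz)⟩
    · rintro s t ⟨S, hS⟩ ⟨S', hS'⟩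
      refine ⟨S ∪ S', ?_⟩
      rintro z (hz | hz) u' h
      · exact hS z hz u' fun l hl => h l (Finset.mem_union_left _ hl)
      · exact hS' z hz u' fun l hl => h l (Finset.mem_union_right _ hl)
    · rintro ⟨u, t⟩ -
      have ho : IsOpen (g ⁻¹' {g (u, t)}) := (isOpen_discrete _).preimage hg
      obtain ⟨V, W, hV, hW, hu, ht, hVW⟩ := isOpen_prod_iff.1 ho u t rfl
      obtain ⟨S, v, hv, hSV⟩ := isOpen_pi_iff.1 hV u hu
      refine ⟨(S : Set L).pi v ×ˢ W, mem_nhdsWithin_of_mem_nhds ?_, S, ?_⟩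
      · exact (IsOpen.prod (isOpen_set_pi S.finite_toSet fun l hl => (hv l hl).1) hW).mem_nhds
          ⟨fun l hl => (hv l hl).2, ht⟩
      · rintro ⟨u1, t1⟩ ⟨h1, h2⟩ u' h
        have h3 : g (u1, t1) = g (u, t) := hVW ⟨hSV h1, h2⟩
        have h4 : g (u', t1) = g (u, t) := hVW ⟨hSV fun l hl => by
          have h5 := h l hl
          dsimp only at h5 ⊢
          rw [h5]
          exact h1 l hl, h2⟩
        rw [h3]
        exact h4
  obtain ⟨S, hS⟩ := key
  exact ⟨S, fun u u' t h => hS (u, t) (Set.mem_univ _) u' h⟩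

namespace CyclotomicPair

open ProfiniteCohomology

variable {p : ℕ} [Fact p.Prime] {B : Type*} [Group B] [TopologicalSpace B] [IsTopologicalGroup B]
  (P : CyclotomicPair p B) {L : Type*}

theorem exists_finset_pullback_eq {n : ℕ} (f : Cochain p (P.Extension L) n) :
    ∃ S : Finset L, ∀ x : Fin n → P.Extension L,
      f (fun i => P.extMap (extL p (Subtype.val : S → L)) (P.extMap (pullL p Subtype.val) (x i))) =
        f x := by
  have := P.isProP.compactSpace
  -- The `l`-th coordinates of all `n` arguments are grouped into one factor, so that a single
  -- finite set serves every argument.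
  let F : (L → Fin n → ℤ_[p]) × (Fin n → B) → (Fin n → P.Extension L) :=
    fun z i => ⟨.ofAdd fun l => z.1 l i, z.2 i⟩
  have hF : Continuous F := by
    refine continuous_pi fun i => continuous_induced_rng.2 ?_
    refine (continuous_ofAdd.comp (continuous_pi fun l => ?_)).prodMk ?_
    · exact (continuous_apply i).comp ((continuous_apply l).comp continuous_fst)
    · exact (continuous_apply i).comp continuous_snd
  obtain ⟨S, hS⟩ := exists_finset_forall_eq (g := fun z => f (F z)) (f.continuous.comp hF)
  refine ⟨S, fun x => ?_⟩
  refine hS (fun l i => (x i).left.toAdd l)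
    (fun l i => extL p (Subtype.val : S → L) (pullL p Subtype.val (x i).left.toAdd) l)
    (fun i => (x i).right) fun l hl => ?_
  funext i
  exact Subtype.val_injective.extend_apply (fun j : S => (x i).left.toAdd j) 0 ⟨l, hl⟩

end CyclotomicPair

/-! ## The first cohomology of `ℤ_p^ι` -/

namespace ProfiniteCohomology

/-- For the trivial action the differential of a `0`-cochain vanishes, so equal classes in `H^1`
have equal cocycles. -/
theorem eq_zero_of_mem_coboundaries_one {p : ℕ} {G : Type*} [Group G] [TopologicalSpace G]
    [IsTopologicalGroup G] {f : Cochain p G 1} (hf : f ∈ coboundaries p G 1) : f = 0 := by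
  obtain ⟨e, rfl⟩ := hf
  ext x
  simp only [d, LinearMap.coe_mk, AddHom.coe_mk, ContinuousMap.coe_mk]
  simp
  rw [add_neg_eq_zero]
  congr 1
  exact Subsingleton.elim _ _

variable {p : ℕ} [Fact p.Prime] {ι : Type*}

theorem continuous_linearCombination (c : ι →₀ ZMod p) :
    Continuous fun a : ι → ℤ_[p] => Finsupp.linearCombination (ZMod p) (redP a) c := by
  simp only [Finsupp.linearCombination_apply, Finsupp.sum]
  refine continuous_finsetSum _ fun i _ => ?_
  exact continuous_const.mul ((continuous_toZMod p).comp (continuous_apply i))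

theorem linearCombination_redP_add (a b : ι → ℤ_[p]) (c : ι →₀ ZMod p) :
    Finsupp.linearCombination (ZMod p) (redP (a + b)) c =
      Finsupp.linearCombination (ZMod p) (redP a) c +
        Finsupp.linearCombination (ZMod p) (redP b) c := by
  have h : redP (a + b) = redP a + redP b := funext fun i => map_add _ (a i) (b i)
  simp only [h, Finsupp.linearCombination_apply, Finsupp.sum, Pi.add_apply, smul_eq_mul, mul_add,
    Finset.sum_add_distrib]

/-- The homomorphism `ℤ_p^ι → ℤ/p` with given coefficients, as a cocycle. -/
def linCocycle : (ι →₀ ZMod p) →ₗ[ZMod p] cocycles p (FreeAbelianProP p ι) 1 where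
  toFun c := ⟨⟨fun x => Finsupp.linearCombination (ZMod p) (redP (x 0).toAdd) c,
    (continuous_linearCombination c).comp (continuous_toAdd.comp (continuous_apply 0))⟩,
    mem_cocycles_of_mul fun x y => linearCombination_redP_add x.toAdd y.toAdd c⟩
  map_add' c c' := by
    ext x
    exact map_add (Finsupp.linearCombination (ZMod p) (redP (x 0).toAdd)) c c'
  map_smul' r c := by
    ext x
    exact map_smul (Finsupp.linearCombination (ZMod p) (redP (x 0).toAdd)) r c

theorem linCocycle_apply (c : ι →₀ ZMod p) (x : Fin 1 → FreeAbelianProP p ι) :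
    (linCocycle c).1 x = Finsupp.linearCombination (ZMod p) (redP (x 0).toAdd) c := rfl

/-- Continuity makes the homomorphism vanish on vectors supported off a finite set `I`. On a single
coordinate it is determined by its value at `1`, by density of `ℕ` in `ℤ_p`. -/
theorem exists_linCocycle_eq (f : cocycles p (FreeAbelianProP p ι) 1) :
    ∃ c, linCocycle c = f := by
  classical
  obtain ⟨f, hf⟩ := f
  let g : (ι → ℤ_[p]) →+ ZMod p := AddMonoidHom.mk' (fun a => f fun _ => .ofAdd a)
    fun a b => mul_of_mem_cocycles hf (.ofAdd a) (.ofAdd b)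
  have hg : Continuous g := f.continuous.comp (continuous_pi fun _ => continuous_ofAdd)
  have ho : IsOpen (g ⁻¹' {0}) := (isOpen_discrete _).preimage hg
  obtain ⟨I, v, hv, hIv⟩ := isOpen_pi_iff.1 ho 0 (map_zero g)
  have h1 : ∀ a : ι → ℤ_[p], (∀ i ∈ I, a i = 0) → g a = 0 := fun a ha =>
    hIv fun i hi => by
      rw [ha i hi]
      exact (hv i hi).2
  have h2 : ∀ (i : ι) (z : ℤ_[p]), g (Pi.single i z) = PadicInt.toZMod z * g (Pi.single i 1) := by
    intro i z
    have h3 : Continuous fun z : ℤ_[p] => g (Pi.single i z) :=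
      hg.comp (ContinuousLinearMap.single ℤ_[p] (fun _ : ι => ℤ_[p]) i).continuous
    have h4 : (fun z : ℤ_[p] => g (Pi.single i z)) =
        fun z => PadicInt.toZMod z * g (Pi.single i 1) := by
      refine PadicInt.denseRange_natCast.equalizer h3
        ((continuous_toZMod p).mul continuous_const) ?_
      funext n
      have h5 : (Pi.single i (n : ℤ_[p]) : ι → ℤ_[p]) = n • Pi.single i 1 := by
        rw [← Pi.single_smul, nsmul_eq_mul, mul_one]
      change g (Pi.single i (n : ℤ_[p])) = PadicInt.toZMod (n : ℤ_[p]) * _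
      rw [h5, map_nsmul, map_natCast, nsmul_eq_mul]
    exact congrFun h4 z
  refine ⟨∑ i ∈ I, Finsupp.single i (g (Pi.single i 1)), Subtype.ext (ContinuousMap.ext fun x => ?_)⟩
  rw [linCocycle_apply, map_sum]
  have h6 : f x = g (x 0).toAdd := by
    change f x = f _
    congr 1
    funext i
    rw [Subsingleton.elim i 0]
    rfl
  have h7 := h1 ((x 0).toAdd - ∑ i ∈ I, Pi.single i ((x 0).toAdd i)) fun j hj => by
    rw [Pi.sub_apply, Finset.sum_apply, Finset.sum_eq_single j, Pi.single_eq_same, sub_self]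
    · exact fun i _ hij => Pi.single_eq_of_ne hij.symm _
    · exact fun h => absurd hj h
  rw [map_sub, sub_eq_zero, map_sum] at h7
  change _ = f x
  rw [h6, h7]
  exact Finset.sum_congr rfl fun i _ => by
    rw [Finsupp.linearCombination_single, smul_eq_mul, h2 i ((x 0).toAdd i), mul_comm]

theorem linCocycle_injective : Function.Injective (linCocycle (p := p) (ι := ι)) := by
  classical
  refine (injective_iff_map_eq_zero _).2 fun c hc => ?_
  ext i
  have := DFunLike.congr_fun (congrArg Subtype.val hc)
    (fun _ => .ofAdd (Pi.single i 1) : Fin 1 → FreeAbelianProP p ι)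
  rw [linCocycle_apply] at this
  have h1 : redP (Pi.single i (1 : ℤ_[p])) = Pi.single i (1 : ZMod p) := by
    funext j
    rw [redP, Pi.single_apply, Pi.single_apply]
    split_ifs <;> simp
  change Finsupp.linearCombination (ZMod p) (redP (Pi.single i (1 : ℤ_[p]))) c = 0 at this
  rw [h1, Finsupp.linearCombination_apply, Finsupp.sum] at this
  simpa [Pi.single_apply] using this

/-- `H^1(ℤ_p^ι)` is the space of finitely supported functions on `ι`. -/
def firstCohomologyEquiv : (ι →₀ ZMod p) ≃ₗ[ZMod p] H p (FreeAbelianProP p ι) 1 :=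
  LinearEquiv.ofBijective (Submodule.mkQ _ ∘ₗ linCocycle) (by
    constructor
    · refine (injective_iff_map_eq_zero _).2 fun c hc => ?_
      have h1 : (linCocycle c).1 ∈ coboundaries p (FreeAbelianProP p ι) 1 :=
        by
        rw [LinearMap.comp_apply, Submodule.mkQ_apply, Submodule.Quotient.mk_eq_zero] at hc
        exact hc
      exact linCocycle_injective ((Subtype.ext (eq_zero_of_mem_coboundaries_one h1)).trans
        (map_zero linCocycle).symm)
    · intro x
      obtain ⟨f, rfl⟩ := Submodule.mkQ_surjective _ x
      obtain ⟨c, rfl⟩ := exists_linCocycle_eq f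
      exact ⟨c, rfl⟩)

theorem firstCohomologyEquiv_apply (c : ι →₀ ZMod p) :
    firstCohomologyEquiv c = cls (linCocycle c).1 (linCocycle c).2 := rfl

end ProfiniteCohomology

/-! ### Coordinates adapted to the classes `β`, and the decomposition -/

namespace CyclotomicPair

open ProfiniteCohomology SemidirectProduct

variable {p : ℕ} [Fact p.Prime] {B : Type*} [Group B] [TopologicalSpace B] [IsTopologicalGroup B]
  (P : CyclotomicPair p B) {ι L : Type*}

/-- A basis of `H^1(ℤ_p^ι)` consists of the reductions of the coordinates with respect to an
isomorphism `ℤ_p^ι ≃ ℤ_p^L`. -/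
theorem exists_equiv_coordCocycle (β : L → H p (P.Extension ι) 1)
    (hβ_indep : LinearIndependent (ZMod p) fun l => map p (inlₜ (P.action ι)) 1 (β l))
    (hβ_span : ⊤ ≤ Submodule.span (ZMod p) (Set.range fun l =>
      map p (inlₜ (P.action ι)) 1 (β l)))
    (hβ_zero : ∀ l, map p (inrₜ (P.action ι)) 1 (β l) = 0) :
    ∃ T : (ι → ℤ_[p]) ≃L[ℤ_[p]] (L → ℤ_[p]), ∀ l,
      map p (P.extMap (T : (ι → ℤ_[p]) →L[ℤ_[p]] (L → ℤ_[p]))) 1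
        (cls (P.coordCocycle l) (P.coordCocycle_mem l)) = β l := by
  let bas : Module.Basis L (ZMod p) (ι →₀ ZMod p) :=
    (Module.Basis.mk hβ_indep hβ_span).map firstCohomologyEquiv.symm
  have hbas : ∀ l, firstCohomologyEquiv (bas l) = map p (inlₜ (P.action ι)) 1 (β l) := fun l => by
    simp [bas]
  obtain ⟨T, hT⟩ := exists_continuousLinearEquiv bas
  refine ⟨T, fun l => ?_⟩
  obtain ⟨b, hb, hbl⟩ := exists_cls_eq (β l)
  have h1 := hbas l
  have h2 := hβ_zero l
  rw [← hbl, map_cls, firstCohomologyEquiv_apply, cls_eq_cls] at h1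
  rw [← hbl, map_cls, cls_eq_zero] at h2
  have h1' := sub_eq_zero.1 (eq_zero_of_mem_coboundaries_one h1)
  have h2' := eq_zero_of_mem_coboundaries_one h2
  rw [← hbl, map_cls, cls_eq_cls]
  suffices h : Cochain.pullback p (P.extMap (T : (ι → ℤ_[p]) →L[ℤ_[p]] (L → ℤ_[p]))) 1
      (P.coordCocycle l) = b by
    rw [h, sub_self]
    exact zero_mem _
  ext x
  -- A homomorphism on the semidirect product is determined by its restrictions to the two factors;
  -- the one to `B` is zero.
  have hx : x = fun _ => inlₜ (P.action ι) (x 0).left * inrₜ (P.action ι) (x 0).right := by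
    funext i
    rw [Subsingleton.elim i 0]
    exact (inl_left_mul_inr_right (x 0)).symm
  have h3 := DFunLike.congr_fun h1' (fun _ => (x 0).left)
  have h4 := DFunLike.congr_fun h2' (fun _ => (x 0).right)
  change _ = b (fun _ => inlₜ (P.action ι) (x 0).left) at h3
  change b (fun _ => inrₜ (P.action ι) (x 0).right) = 0 at h4
  conv_rhs => rw [hx, mul_of_mem_cocycles hb, h4, add_zero, ← h3]
  exact hT (x 0).left.toAdd l

variable [LinearOrder L]

/-- The approximating maps change coordinates by `T` and project, or extend by zero and change back.
The coordinate at `l` then restricts to zero on `ℤ_p^S ⋊ B` when `l ∉ S`. -/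
theorem decomposes_univ (β : L → H p (P.Extension ι) 1)
    (T : (ι → ℤ_[p]) ≃L[ℤ_[p]] (L → ℤ_[p]))
    (hT : ∀ l, map p (P.extMap (T : (ι → ℤ_[p]) →L[ℤ_[p]] (L → ℤ_[p]))) 1
      (cls (P.coordCocycle l) (P.coordCocycle_mem l)) = β l) :
    Decomposes (rightHomₜ (P.action ι)) β Set.univ := by
  refine Decomposes.of_forall_finset (K := fun S : Finset L => P.Extension S)
    (fun S => rightHomₜ (P.action S))
    (fun S => (P.extMap (pullL p (Subtype.val : S → L))).comp
      (P.extMap (T : (ι → ℤ_[p]) →L[ℤ_[p]] (L → ℤ_[p]))))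
    (fun S => (P.extMap (T.symm : (L → ℤ_[p]) →L[ℤ_[p]] (ι → ℤ_[p]))).comp
      (P.extMap (extL p (Subtype.val : S → L))))
    (fun S => P.coordClass S) (fun S => P.decomposes_finset S) (fun S => rfl) (fun S => rfl)
    (fun S l hl => ?_) (fun S l => ?_) (fun S l hl => P.coordClass_of_notMem hl) (fun i x => ?_)
  · rw [P.coordClass_of_mem hl, ← hT, map_cls, map_cls]
    rfl
  · rw [← hT, map_cls, map_cls]
    have h : ∀ x : Fin 1 → P.Extension S,
        Cochain.pullback p ((P.extMap (T.symm : (L → ℤ_[p]) →L[ℤ_[p]] (ι → ℤ_[p]))).comp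
          (P.extMap (extL p (Subtype.val : S → L)))) 1 (Cochain.pullback p
            (P.extMap (T : (ι → ℤ_[p]) →L[ℤ_[p]] (L → ℤ_[p]))) 1 (P.coordCocycle l)) x =
          PadicInt.toZMod (Function.extend Subtype.val (x 0).left.toAdd 0 l) := fun x => by
      change PadicInt.toZMod (T (T.symm _) l) = _
      rw [T.apply_symm_apply]
      rfl
    by_cases hl : l ∈ S
    · rw [P.coordClass_of_mem hl, cls_eq_cls, sub_eq_zero.2]
      · exact zero_mem _
      · ext x
        rw [h]
        exact congrArg _ (Subtype.val_injective.extend_apply (x 0).left.toAdd 0 (⟨l, hl⟩ : S))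
    · rw [P.coordClass_of_notMem hl, cls_eq_zero]
      have h0 : Cochain.pullback p ((P.extMap (T.symm : (L → ℤ_[p]) →L[ℤ_[p]] (ι → ℤ_[p]))).comp
          (P.extMap (extL p (Subtype.val : S → L)))) 1 (Cochain.pullback p
            (P.extMap (T : (ι → ℤ_[p]) →L[ℤ_[p]] (L → ℤ_[p]))) 1 (P.coordCocycle l)) = 0 := by
        ext x
        rw [h, Function.extend_apply' _ _ _ (by rintro ⟨y, rfl⟩; exact hl y.2)]
        exact map_zero _
      rw [h0]
      exact zero_mem _
  -- A representative, read in the coordinates of `T`, depends on finitely many of them, so the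
  -- identity already holds for cochains.
  · obtain ⟨f, hf, rfl⟩ := exists_cls_eq x
    obtain ⟨S, hS⟩ := P.exists_finset_pullback_eq (Cochain.pullback p
      (P.extMap (T.symm : (L → ℤ_[p]) →L[ℤ_[p]] (ι → ℤ_[p]))) i f)
    refine ⟨S, ?_⟩
    rw [map_cls, map_cls, cls_eq_cls, sub_eq_zero.2]
    · exact zero_mem _
    · ext x
      refine (hS fun t => P.extMap (T : (ι → ℤ_[p]) →L[ℤ_[p]] (L → ℤ_[p])) (x t)).trans ?_
      change f _ = f x
      congr 1
      funext t
      exact P.extension_ext (fun i => congrFun (T.symm_apply_apply (x t).left.toAdd) i) rfl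

end CyclotomicPair

/-- An increasing sequence is recovered from its range. This converts the comparison of ranges in
`Decomposes` to distinctness of summation indices. -/
theorem range_injective_of_orderEmbedding {L : Type*} [LinearOrder L] {j j' : ℕ} (s : Fin j ↪o L)
    (s' : Fin j' ↪o L) (h : Set.range s = Set.range s') :
    (⟨j, s⟩ : Σ j : ℕ, Fin j ↪o L) = ⟨j', s'⟩ := by
  have hj : j = j' := by
    have h1 := Set.ncard_range_of_injective s.injective
    have h2 := Set.ncard_range_of_injective s'.injective
    rw [h, h2, Nat.card_fin, Nat.card_fin] at h1
    exact h1.symm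
  subst hj
  congr 1
  refine DFunLike.coe_injective ?_
  exact (StrictMono.range_inj s.strictMono s'.strictMono).1 h

end

theorem mainTheorem9 (p : ℕ) [Fact p.Prime]
    {Gbar : Type*} [Group Gbar] [TopologicalSpace Gbar] [IsTopologicalGroup Gbar]
    (P : CyclotomicPair p Gbar) (ι : Type*) {L : Type*} [LinearOrder L]
    (β : L → ProfiniteCohomology.H p (P.Extension ι) 1)
    (hβ_indep : LinearIndependent (ZMod p) fun l =>
      ProfiniteCohomology.map p (SemidirectProduct.inlₜ (P.action ι)) 1 (β l))
    (hβ_span : ⊤ ≤ Submodule.span (ZMod p) (Set.range fun l =>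
      ProfiniteCohomology.map p (SemidirectProduct.inlₜ (P.action ι)) 1 (β l)))
    (hβ_zero : ∀ l, ProfiniteCohomology.map p (SemidirectProduct.inrₜ (P.action ι)) 1 (β l) = 0)
    (i : ℕ) :
    DirectSum.IsInternal (fun s : (Σ j : Fin (i + 1), Fin j ↪o L) =>
      LinearMap.range (P.infCup ι (Nat.le_of_lt_succ s.1.2) fun t => β (s.2 t))) ∧
    ∀ (j : ℕ) (hj : j ≤ i) (l : Fin j ↪o L),
      Function.Injective (P.infCup ι hj fun t => β (l t)) := by
  obtain ⟨T, hT⟩ := P.exists_equiv_coordCocycle β hβ_indep hβ_span hβ_zero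
  have hd := P.decomposes_univ β T hT
  constructor
  · rw [DirectSum.isInternal_submodule_iff_iSupIndep_and_iSup_eq_top]
    constructor
    · rintro ⟨j, s⟩
      obtain ⟨c, hc1, hc2⟩ := hd.proj (i - j) j i (Nat.sub_add_cancel (Nat.le_of_lt_succ j.2)) s
        (Set.subset_univ _)
      rw [Submodule.disjoint_def]
      rintro _ ⟨y, rfl⟩ hx
      -- The retraction for `s` kills the span of all other summands, so an element common to both
      -- is the image of `0`.
      have hle : (⨆ s' : Σ j : Fin (i + 1), Fin j ↪o L, ⨆ _ : s' ≠ ⟨j, s⟩, LinearMap.range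
          (P.infCup ι (Nat.le_of_lt_succ s'.1.2) fun t => β (s'.2 t))) ≤ LinearMap.ker c := by
        refine iSup₂_le ?_
        rintro ⟨j', s'⟩ hne _ ⟨z, rfl⟩
        refine hc2 (i - j') j' (Nat.sub_add_cancel (Nat.le_of_lt_succ j'.2)) s' (Set.subset_univ _)
          (fun h => hne ?_) z
        have h1 := range_injective_of_orderEmbedding s' s h
        obtain ⟨j, hj⟩ := j
        obtain ⟨j', hj'⟩ := j'
        obtain rfl : j' = j := congrArg Sigma.fst h1
        rw [eq_of_heq (Sigma.mk.inj h1).2]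
      have h0 : y = 0 := (hc1 y).symm.trans (hle hx)
      rw [h0, map_zero]
    · refine eq_top_iff.2 fun x _ => ?_
      refine Submodule.span_le.2 ?_ (hd.span i x)
      rintro _ ⟨k, j, h, s, y, -, rfl⟩
      obtain rfl : k = i - j := by omega
      exact Submodule.mem_iSup_of_mem (⟨⟨j, by omega⟩, s⟩ : Σ j : Fin (i + 1), Fin j ↪o L) ⟨y, rfl⟩
  · intro j hj l
    obtain ⟨c, hc, -⟩ := hd.proj (i - j) j i (Nat.sub_add_cancel hj) l (Set.subset_univ _)
    exact Function.LeftInverse.injective (g := c) hc
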